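/- **Conventions.** All maps are $C^\infty$. For a nondegenerate hypersurface immersion $f\colon M^n\to\mathbb R^{n+1}$ with affine (Blaschke) normal $\xi$ (transversal, $D\xi$ tangential, $|\det(f_*X_1,\dots,f_*X_n,\xi)|=|\det h(X_i,X_j)|^{1/2}$; unique up to sign) let $h$, $\nabla$, $S$ be given by $D_XY=\nabla_XY+h(X,Y)\xi$, $D_X\xi=-SX$, and let $K=\nabla-\hat\nabla$, where $\hat\nabla$ is the Levi-Civita connection of $h$. The immersion is an affine hypersphere of mean curvature $H$ if $S=H\,\mathrm{Id}$ with $H$ constant; it is called improper if $H=0$, and proper of normalized mean curvature if $H=\pm1$. A three-dimensional affine hypersphere is called indefinite if $h$ is; then $\xi$ is oriented so that $h$ has exactly one negative direction. An orthonormal basis of $T_pM$ is a basis $(\mathbf t,\mathbf v,\mathbf w)$ with $h(\mathbf t,\mathbf t)=-1$, $h(\mathbf v,\mathbf v)=h(\mathbf w,\mathbf w)=1$ and all other products zero; with respect to it let $A_s$ be the linear map that fixes $\mathbf t$ and rotates the $(\mathbf v,\mathbf w)$-plane by the angle $s$, and put $SO(2)=\{A_s: s\in\mathbb R\}$ and $\mathbb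 Z_3=\langle A_{2\pi/3}\rangle$. For $G\in\{\mathbb Z_3,SO(2)\}$ the hypersurface admits a pointwise $G$-symmetry if every $T_pM$ has an orthonormal basis with respect to which all elements of $G$ preserve $h$, $K$ and $S$ at $p$. **Theorem.** Let $N^2$ be a smooth surface and let $\phi\colon N^2\to\mathbb R^3$ be a positive definite elliptic ($\varepsilon_1=1$) or hyperbolic ($\varepsilon_1=-1$) affine sphere with mean curvature $\varepsilon_1$ centred at the origin, i.e. with affine normal $-\varepsilon_1\phi$ and positive definite affine metric. Let $\gamma=(\gamma_1,\gamma_2)\colon I\to\mathbb R^2$ be a smooth curve on an open interval $I$, and put $$\varphi\colon I\times N^2\to\mathbb R^4,\qquad \varphi(t,q)=(\gamma_1(t),\gamma_2(t)\,\phi(q)).$$ 1. If $\varphi$ is a three-dimensional indefinite affine hypersphere, then $\varphi$ admits a pointwise $\mathbb Z_3$- or $SO(2)$-symmetry. More precisely, at each point $p$ there is an orthonormal basis $(\mathbf t,\mathbf v,\mathbf w)$ such that the group of those $A_s$ that preserve $K$ at $p$ is exactly $\mathbb Z_3$ or exactly $SO(2)$; and if $K(\mathbf t,\mathbf t)\neq0$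 at $p$, then this group is the whole stabilizer of $K$ at $p$ in $SO(1,2)$. 2. If on all of $I$ $$\gamma_2^2\,|\gamma_1\gamma_2'-\gamma_1'\gamma_2|^5=\operatorname{sign}(\gamma_1'\gamma_2\varepsilon_1)\,(\gamma_1'\gamma_2''-\gamma_1''\gamma_2')\,(\gamma_1')^2\neq0,$$ then $\varphi$ is a three-dimensional indefinite proper affine hypersphere (with $H=\pm1$). 3. If on all of $I$ $$\gamma_2^2\,|\gamma_2'|^5=\operatorname{sign}(\gamma_1'\gamma_2\varepsilon_1)\,(\gamma_1'\gamma_2''-\gamma_1''\gamma_2')\,(\gamma_1')^2\neq0,$$ then $\varphi$ is a three-dimensional indefinite improper affine hypersphere. -/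

import Mathlib

open scoped Manifold ContDiff

noncomputable section

namespace AffineGeom

/-! ### Equi-affine hypersurface theory in a coordinate domain

`f` is a map from a (coordinate domain in a) vector space `E` to `ℝⁿ⁺¹` and `ξ` is a vector field
along `f`. Tangent vectors are elements of `E`, and they also stand for constant vector fields. -/

section Coordinates

variable {E : Type*} [NormedAddCommGroup E] [NormedSpace ℝ E] {n : ℕ}

/-- The map `(X, c) ↦ f_* X + c ξ` from `E × ℝ` to `ℝⁿ⁺¹` at the point `y`. -/
def frame (f ξ : E → Fin (n + 1) → ℝ) (y : E) : E × ℝ →L[ℝ] (Fin (n + 1) → ℝ) :=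
  (fderiv ℝ f y).coprod (ContinuousLinearMap.toSpanSingleton ℝ (ξ y))

/-- The decomposition `v = f_* X + c ξ ↦ (X, c)` of vectors of `ℝⁿ⁺¹` into the tangential and the
transversal component (the inverse of `frame`, which is meaningful if `frame` is bijective). -/
def split (f ξ : E → Fin (n + 1) → ℝ) (y : E) : (Fin (n + 1) → ℝ) →L[ℝ] E × ℝ :=
  (frame f ξ y).inverse

/-- The affine metric `h`, the transversal part in the Gauss formula
`D_X D_Y f = f_* (∇_X Y) + h(X,Y) ξ`. -/
def metric (f ξ : E → Fin (n + 1) → ℝ) (y : E) : E →L[ℝ] E →L[ℝ] ℝ :=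
  (ContinuousLinearMap.compL ℝ E (Fin (n + 1) → ℝ) ℝ
    ((ContinuousLinearMap.snd ℝ E ℝ).comp (split f ξ y))).comp (fderiv ℝ (fderiv ℝ f) y)

/-- The Christoffel form `∇_X Y` (for constant `X`, `Y`) of the induced connection, the tangential
part in the Gauss formula. -/
def inducedConnection (f ξ : E → Fin (n + 1) → ℝ) (y X Y : E) : E :=
  (split f ξ y (fderiv ℝ (fderiv ℝ f) y X Y)).1

/-- The affine shape operator `S`, from the Weingarten formula `D_X ξ = - f_* (S X) + τ(X) ξ`. -/
def shape (f ξ : E → Fin (n + 1) → ℝ) (y X : E) : E :=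
  -(split f ξ y (fderiv ℝ ξ y X)).1

/-- The transversal connection form `τ` in the formula `D_X ξ = - f_* (S X) + τ(X) ξ`. -/
def transversalForm (f ξ : E → Fin (n + 1) → ℝ) (y X : E) : ℝ :=
  (split f ξ y (fderiv ℝ ξ y X)).2

/-- The one-form `Z ↦ ½ (X h(Y,Z) + Y h(X,Z) - Z h(X,Y))` for constant `X`, `Y`. -/
def koszulForm (g : E → E →L[ℝ] E →L[ℝ] ℝ) (y X Y : E) : E →L[ℝ] ℝ :=
  (1 / 2 : ℝ) • (fderiv ℝ g y X Y + fderiv ℝ g y Y X - ((fderiv ℝ g y).flip X).flip Y)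

/-- The Christoffel form of the Levi-Civita connection of a nondegenerate metric `g`: the vector
`W` with `g(W, Z) = ½ (X g(Y,Z) + Y g(X,Z) - Z g(X,Y))` for all `Z`. -/
def leviCivita (g : E → E →L[ℝ] E →L[ℝ] ℝ) (y X Y : E) : E :=
  (g y).inverse (koszulForm g y X Y)

/-- The difference tensor `K(X,Y) = ∇_X Y - ∇̂_X Y`. -/
def differenceTensor (f ξ : E → Fin (n + 1) → ℝ) (y X Y : E) : E :=
  inducedConnection f ξ y X Y - leviCivita (metric f ξ) y X Y

/-- At `y`, the map `f` is a nondegenerate immersion and `ξ` satisfies the conditions that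
characterize the affine (Blaschke) normal up to sign. -/
structure IsBlaschkeNormalAt (f ξ : E → Fin (n + 1) → ℝ) (y : E) : Prop where
  /-- `f` is an immersion and `ξ` is transversal: `ℝⁿ⁺¹ = f_* E ⊕ ℝ ξ`. -/
  transversal : Function.Bijective (frame f ξ y)
  /-- The affine metric is nondegenerate. -/
  nondegenerate : ∀ X : E, (∀ Y : E, metric f ξ y X Y = 0) → X = 0
  /-- `D ξ` is tangential. -/
  tangential : ∀ X : E, transversalForm f ξ y X = 0
  /-- The induced volume `|det (f_* X₁, …, f_* Xₙ, ξ)|` is the volume `|det h(Xᵢ, Xⱼ)|^(1/2)`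
  of the affine metric. -/
  volume_eq : ∀ X : Fin n → E,
    |Matrix.det (Matrix.of (Fin.snoc (α := fun _ => Fin (n + 1) → ℝ)
      (fun i => fderiv ℝ f y (X i)) (ξ y)))|
      = Real.sqrt |Matrix.det (Matrix.of fun i j => metric f ξ y (X i) (X j))|

end Coordinates

/-! ### Hypersurfaces parametrized by a manifold

`M` is a manifold without boundary modelled on `E`. As everywhere in Mathlib, the tangent space at
`p` is identified with `E` by the preferred chart at `p`; the tensors at `p` are computed in this
chart. -/

section Manifold

variable {E : Type*} [NormedAddCommGroup E] [NormedSpace ℝ E] {H : Type*} [TopologicalSpace H]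
  (I : ModelWithCorners ℝ E H) [I.Boundaryless]
  {M : Type*} [TopologicalSpace M] [ChartedSpace H M] {n : ℕ}

/-- The map `f`, written in the preferred chart at `p`. -/
def inChart (f : M → Fin (n + 1) → ℝ) (p : M) : E → Fin (n + 1) → ℝ :=
  f ∘ (extChartAt I p).symm

/-- The affine metric `h` at `p`, a bilinear form on `T_p M`. -/
def metricAt (f ξ : M → Fin (n + 1) → ℝ) (p : M) : E →L[ℝ] E →L[ℝ] ℝ :=
  metric (inChart I f p) (inChart I ξ p) (extChartAt I p p)

/-- The difference tensor `K` at `p`. -/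
def differenceTensorAt (f ξ : M → Fin (n + 1) → ℝ) (p : M) (X Y : E) : E :=
  differenceTensor (inChart I f p) (inChart I ξ p) (extChartAt I p p) X Y

/-- The affine shape operator `S` at `p`. -/
def shapeAt (f ξ : M → Fin (n + 1) → ℝ) (p : M) (X : E) : E :=
  shape (inChart I f p) (inChart I ξ p) (extChartAt I p p) X

/-- On the open set `U`, the map `f` is a smooth nondegenerate hypersurface immersion into `ℝⁿ⁺¹`
and `ξ` is its affine (Blaschke) normal (which is unique up to sign). The conditions are required
in all preferred charts, at all points of their domains that lie in `U`. -/
structure IsBlaschkeImmersionOn (f ξ : M → Fin (n + 1) → ℝ) (U : Set M) : Prop where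
  smooth : ContMDiffOn I 𝓘(ℝ, Fin (n + 1) → ℝ) ∞ f U
  smooth_normal : ContMDiffOn I 𝓘(ℝ, Fin (n + 1) → ℝ) ∞ ξ U
  blaschke : ∀ p : M, ∀ y ∈ (extChartAt I p).target, (extChartAt I p).symm y ∈ U →
    IsBlaschkeNormalAt (inChart I f p) (inChart I ξ p) y

/-- `f` is an affine hypersphere on `U` with affine normal `ξ` and affine mean curvature `c`:
the affine shape operator is `S = c Id` with a constant `c`. -/
structure IsAffineHypersphereOn (f ξ : M → Fin (n + 1) → ℝ) (c : ℝ) (U : Set M) : Prop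
    extends IsBlaschkeImmersionOn I f ξ U where
  shape_eq : ∀ p : M, ∀ y ∈ (extChartAt I p).target, (extChartAt I p).symm y ∈ U →
    ∀ X : E, shape (inChart I f p) (inChart I ξ p) y X = c • X

/-- `b = (t, v, w)` is an orthonormal basis of a three-dimensional Lorentz space:
`h(t,t) = -1`, `h(v,v) = h(w,w) = 1`, and the other products vanish. -/
def IsLorentzONB (h : E →L[ℝ] E →L[ℝ] ℝ) (b : Module.Basis (Fin 3) ℝ E) : Prop :=
  ∀ i j, h (b i) (b j) = Matrix.diagonal ![(-1 : ℝ), 1, 1] i j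

/-- `f` is a three-dimensional indefinite affine hypersphere on `U` with affine mean curvature `c`
and with affine normal `ξ`, which is oriented such that the affine metric has exactly one negative
direction. -/
structure IsIndefiniteAffineHypersphereOn (f ξ : M → Fin 4 → ℝ) (c : ℝ) (U : Set M) : Prop
    extends IsAffineHypersphereOn I f ξ c U where
  lorentz : ∀ p ∈ U, ∃ b : Module.Basis (Fin 3) ℝ E, IsLorentzONB (metricAt I f ξ p) b

/-- The set of those endomorphisms of determinant one of `T_p M`, written as matrices with
respect to the basis `b`, that preserve `h`, `K` and `S` at `p`. If `b` is a Lorentz orthonormal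
basis, then this is the stabilizer in `SO(1,2)` of the difference tensor and the shape operator. -/
def symmetriesAt (f ξ : M → Fin 4 → ℝ) (p : M) (b : Module.Basis (Fin 3) ℝ E) :
    Set (Matrix.SpecialLinearGroup (Fin 3) ℝ) :=
  {A | let L : E →ₗ[ℝ] E := Matrix.toLin b b A.1
    (∀ X Y, metricAt I f ξ p (L X) (L Y) = metricAt I f ξ p X Y) ∧
    (∀ X Y, differenceTensorAt I f ξ p (L X) (L Y) = L (differenceTensorAt I f ξ p X Y)) ∧
    (∀ X, shapeAt I f ξ p (L X) = L (shapeAt I f ξ p X))}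

/-- The hypersurface `f` with affine normal `ξ` admits a pointwise `G`-symmetry on `U`, where `G`
is a group of matrices: at every point `h`, `K` and `S` are preserved by `G`, acting through some
Lorentz orthonormal basis of the tangent space. -/
def AdmitsPointwiseSymmetryOn (f ξ : M → Fin 4 → ℝ) (U : Set M)
    (G : Subgroup (Matrix.SpecialLinearGroup (Fin 3) ℝ)) : Prop :=
  ∀ p ∈ U, ∃ b : Module.Basis (Fin 3) ℝ E, IsLorentzONB (metricAt I f ξ p) b ∧
    (G : Set (Matrix.SpecialLinearGroup (Fin 3) ℝ)) ⊆ symmetriesAt I f ξ p b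

end Manifold

/-- The matrix `A_s` of the rotation by the angle `s` about the timelike axis of a Lorentz
orthonormal basis `(t, v, w)`. -/
def rotationMatrix (s : ℝ) : Matrix (Fin 3) (Fin 3) ℝ :=
  !![1, 0, 0;
    0, Real.cos s, -Real.sin s;
    0, Real.sin s, Real.cos s]

theorem det_rotationMatrix (s : ℝ) : (rotationMatrix s).det = 1 := by
  simp [rotationMatrix, Matrix.det_fin_three]
  nlinarith [Real.sin_sq_add_cos_sq s]

theorem rotationMatrix_zero : rotationMatrix 0 = 1 := by
  ext i j
  fin_cases i <;> fin_cases j <;> simp [rotationMatrix]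

theorem rotationMatrix_add (s u : ℝ) :
    rotationMatrix (s + u) = rotationMatrix s * rotationMatrix u := by
  ext i j
  fin_cases i <;> fin_cases j <;>
    simp [rotationMatrix, Matrix.mul_apply, Fin.sum_univ_three, Real.cos_add, Real.sin_add] <;>
    ring

/-- The homomorphism `s ↦ A_s` from the additive group `ℝ` to the matrices of determinant one. -/
def rotation : Multiplicative ℝ →* Matrix.SpecialLinearGroup (Fin 3) ℝ where
  toFun s := ⟨rotationMatrix s.toAdd, det_rotationMatrix s.toAdd⟩
  map_one' := Subtype.ext rotationMatrix_zero
  map_mul' s u := Subtype.ext (rotationMatrix_add s.toAdd u.toAdd)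

/-- `SO(2)`, the group of all rotations `A_s`. -/
def groupSO2 : Subgroup (Matrix.SpecialLinearGroup (Fin 3) ℝ) := rotation.range

/-- `ℤ₃`, the group generated by the rotation `A_{2π/3}`. -/
def groupZ3 : Subgroup (Matrix.SpecialLinearGroup (Fin 3) ℝ) :=
  Subgroup.zpowers (rotation (Multiplicative.ofAdd (2 * Real.pi / 3)))

/-- `φ : N → ℝ³` is a positive definite elliptic (`ε = 1`) or hyperbolic (`ε = -1`) affine sphere
centred at the origin, with affine mean curvature `ε`, i.e. with affine normal `-ε φ`. -/
def IsDefiniteProperAffineSphere {N : Type*} [TopologicalSpace N]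
    [ChartedSpace (EuclideanSpace ℝ (Fin 2)) N] (φ : N → Fin 3 → ℝ) (ε : ℝ) : Prop :=
  (ε = 1 ∨ ε = -1) ∧
  IsAffineHypersphereOn (𝓡 2) φ (fun q => -(ε • φ q)) ε Set.univ ∧
  ∀ q : N, ∀ X : EuclideanSpace ℝ (Fin 2), X ≠ 0 →
    0 < metricAt (𝓡 2) φ (fun q => -(ε • φ q)) q X X

/-- The map `(t, q) ↦ (γ₁(t), γ₂(t) φ(q))`. -/
def warp {N : Type*} (γ₁ γ₂ : ℝ → ℝ) (φ : N → Fin 3 → ℝ) : ℝ × N → Fin 4 → ℝ :=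
  fun x => Matrix.vecCons (γ₁ x.1) (γ₂ x.1 • φ x.2)

/-- The model of the product manifold `ℝ × N` for a surface `N`. -/
abbrev modelProd : ModelWithCorners ℝ (ℝ × EuclideanSpace ℝ (Fin 2))
    (ModelProd ℝ (EuclideanSpace ℝ (Fin 2))) :=
  𝓘(ℝ, ℝ).prod (𝓡 2)

end AffineGeom

end

open AffineGeom

open Filter Topology

/-! Let `W` be the Wronskian γ₁'γ₂'' - γ₁''γ₂' and let (0, φ) denote the position vector of the
surface inside ℝ⁴. Since the affine normal of φ is -εφ, each second derivative of the warped map f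
is tangential up to a multiple of (0, φ): the factor is -εγ₂ times the affine metric of φ on surface
directions, 0 on mixed pairs, and W/γ₁' on (∂ₜ, ∂ₜ). So for any transversal ξ the affine metric is
block diagonal, and ξ enters it only through one function σ = `radial`, the ξ-component of (0, φ).
The volume condition then becomes |γ₁'|³γ₂² = |σ|⁵|W| (`IsWarpDatum.volume_iff`), from which the
surface has disappeared.

Symmetry. By the volume condition σ is constant along the surface. Hence the cubic form -½∇h
vanishes on (X, ∂ₜ, ∂ₜ) and is a multiple of the surface metric on (∂ₜ, X, Y). With total symmetry
(from Codazzi) and `apolarity`, this leaves in an adapted orthonormal basis (t, v, w) only a number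
l with K(t,t) = l t and a trace-free binary cubic form on the (v,w)-plane (`IsNormalForm`). The
rotation by s turns that cubic form by 3s, so its stabilizer in SO(2) is ℤ₃, or everything if it is
zero. If l ≠ 0, the tensor K and the metric single out t, and every symmetry is a rotation about t.

Construction. The field ξ = k∂₀ - cf satisfies Dξ = -c Df for free, so only the volume condition and
the signature are left. Here σ = γ₁'/D with D = -cγ₁'γ₂ - γ₂'(k - cγ₁). The differential equation is
the volume condition for this σ, and its sign factor makes h Lorentzian once c (with k = 0) or k
(with c = 0) is chosen as ±1 according to the sign of a function without zeros on the interval. -/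

namespace AffineGeom

/-! ### Gauss and Weingarten decomposition in coordinates. -/

section Structure

variable {E : Type*} [NormedAddCommGroup E] [NormedSpace ℝ E] {n : ℕ}
  {f ξ : E → Fin (n + 1) → ℝ} {y : E}

/-- `f` and `ξ` are smooth near `y`, and `ξ` is a Blaschke normal of `f` near `y`. -/
def IsBlaschkeNear (f ξ : E → Fin (n + 1) → ℝ) (y : E) : Prop :=
  ∀ᶠ z in 𝓝 y, ContDiffAt ℝ ∞ f z ∧ ContDiffAt ℝ ∞ ξ z ∧ IsBlaschkeNormalAt f ξ z

theorem isSymmSndFDerivAt_of_smooth {E F : Type*} [NormedAddCommGroup E] [NormedSpace ℝ E]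
    [NormedAddCommGroup F] [NormedSpace ℝ F] {f : E → F} {y : E} (hf : ContDiffAt ℝ ∞ f y) :
    IsSymmSndFDerivAt ℝ f y :=
  hf.isSymmSndFDerivAt (by
    rw [minSmoothness_of_isRCLikeNormedField]
    exact WithTop.coe_le_coe.2 (le_top : (2 : ℕ∞) ≤ ⊤))

theorem frame_apply (f ξ : E → Fin (n + 1) → ℝ) (y : E) (x : E × ℝ) :
    frame f ξ y x = fderiv ℝ f y x.1 + x.2 • ξ y := by
  simp [frame]

theorem metric_apply (f ξ : E → Fin (n + 1) → ℝ) (y X Y : E) :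
    metric f ξ y X Y = (split f ξ y (fderiv ℝ (fderiv ℝ f) y X Y)).2 := rfl

theorem metric_symm (hf : ContDiffAt ℝ ∞ f y) (X Y : E) :
    metric f ξ y X Y = metric f ξ y Y X := by
  rw [metric_apply, metric_apply, (isSymmSndFDerivAt_of_smooth hf).eq]

theorem inducedConnection_symm (hf : ContDiffAt ℝ ∞ f y) (X Y : E) :
    inducedConnection f ξ y X Y = inducedConnection f ξ y Y X := by
  rw [inducedConnection, inducedConnection, (isSymmSndFDerivAt_of_smooth hf).eq]

theorem differenceTensor_add_left (X X' Y : E) :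
    differenceTensor f ξ y (X + X') Y =
      differenceTensor f ξ y X Y + differenceTensor f ξ y X' Y := by
  have : koszulForm (metric f ξ) y (X + X') Y =
      koszulForm (metric f ξ) y X Y + koszulForm (metric f ξ) y X' Y := by
    ext Z; simp [koszulForm]; ring
  simp only [differenceTensor, inducedConnection, leviCivita, this, map_add,
    add_apply, Prod.fst_add]
  abel

theorem differenceTensor_smul_left (c : ℝ) (X Y : E) :
    differenceTensor f ξ y (c • X) Y = c • differenceTensor f ξ y X Y := by
  have : koszulForm (metric f ξ) y (c • X) Y = c • koszulForm (metric f ξ) y X Y := by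
    ext Z; simp [koszulForm]; ring
  simp only [differenceTensor, inducedConnection, leviCivita, this, map_smul,
    smul_apply, Prod.smul_fst, smul_sub]

theorem differenceTensor_add_right (X Y Y' : E) :
    differenceTensor f ξ y X (Y + Y') =
      differenceTensor f ξ y X Y + differenceTensor f ξ y X Y' := by
  have : koszulForm (metric f ξ) y X (Y + Y') =
      koszulForm (metric f ξ) y X Y + koszulForm (metric f ξ) y X Y' := by
    ext Z; simp [koszulForm]; ring
  simp only [differenceTensor, inducedConnection, leviCivita, this, map_add, Prod.fst_add]
  abel

theorem differenceTensor_smul_right (c : ℝ) (X Y : E) :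
    differenceTensor f ξ y X (c • Y) = c • differenceTensor f ξ y X Y := by
  have : koszulForm (metric f ξ) y X (c • Y) = c • koszulForm (metric f ξ) y X Y := by
    ext Z; simp [koszulForm]; ring
  simp only [differenceTensor, inducedConnection, leviCivita, this, map_smul,
    Prod.smul_fst, smul_sub]

/-- The difference tensor as a bilinear map. -/
noncomputable def differenceBilin (f ξ : E → Fin (n + 1) → ℝ) (y : E) : E →ₗ[ℝ] E →ₗ[ℝ] E :=
  LinearMap.mk₂ ℝ (differenceTensor f ξ y) differenceTensor_add_left
    differenceTensor_smul_left differenceTensor_add_right differenceTensor_smul_right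

theorem differenceBilin_apply (X Y : E) :
    differenceBilin f ξ y X Y = differenceTensor f ξ y X Y := rfl

variable [FiniteDimensional ℝ E]

theorem isInvertible_frame (h : Function.Bijective (frame f ξ y)) :
    (frame f ξ y).IsInvertible :=
  ⟨ContinuousLinearEquiv.ofBijective (frame f ξ y) (LinearMap.ker_eq_bot.2 h.1)
    (LinearMap.range_eq_top.2 h.2), rfl⟩

theorem split_frame (h : Function.Bijective (frame f ξ y)) (x : E × ℝ) :
    split f ξ y (frame f ξ y x) = x :=
  (isInvertible_frame h).inverse_apply_self x

theorem frame_split (h : Function.Bijective (frame f ξ y)) (v : Fin (n + 1) → ℝ) :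
    frame f ξ y (split f ξ y v) = v :=
  (isInvertible_frame h).self_apply_inverse v

theorem split_add_smul (h : Function.Bijective (frame f ξ y)) (X : E) (c : ℝ) :
    split f ξ y (fderiv ℝ f y X + c • ξ y) = (X, c) := by
  rw [← split_frame h (X, c), frame_apply]

theorem split_fderiv (h : Function.Bijective (frame f ξ y)) (X : E) :
    split f ξ y (fderiv ℝ f y X) = (X, 0) := by
  simpa using split_add_smul h X 0

theorem split_normal (h : Function.Bijective (frame f ξ y)) :
    split f ξ y (ξ y) = (0, 1) := by
  simpa using split_add_smul h 0 1

theorem fderiv_split_add (h : Function.Bijective (frame f ξ y)) (v : Fin (n + 1) → ℝ) :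
    fderiv ℝ f y (split f ξ y v).1 + (split f ξ y v).2 • ξ y = v := by
  rw [← frame_apply, frame_split h]

theorem gauss (h : Function.Bijective (frame f ξ y)) (X Y : E) :
    fderiv ℝ (fderiv ℝ f) y X Y =
      fderiv ℝ f y (inducedConnection f ξ y X Y) + metric f ξ y X Y • ξ y :=
  (fderiv_split_add h _).symm

/-- Inversion of continuous linear maps is smooth at an invertible map, and `frame` is smooth in the
derivative of `f` and in `ξ`. -/
theorem contDiffAt_split (hf : ContDiffAt ℝ ∞ f y) (hξ : ContDiffAt ℝ ∞ ξ y)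
    (h : Function.Bijective (frame f ξ y)) : ContDiffAt ℝ ∞ (split f ξ) y := by
  have hF : ContDiffAt ℝ ∞ (frame f ξ) y := by
    have h1 : ContDiffAt ℝ ∞ (fderiv ℝ f) y := hf.fderiv_right (by simp)
    have : frame f ξ = fun z => (fderiv ℝ f z).comp (ContinuousLinearMap.fst ℝ E ℝ) +
        (ContinuousLinearMap.smulRightL ℝ (E × ℝ) _ (ContinuousLinearMap.snd ℝ E ℝ)) (ξ z) := by
      ext z x <;> simp [frame]
    rw [this]
    exact (h1.clm_comp contDiffAt_const).add
      ((ContinuousLinearMap.contDiff _).contDiffAt.comp y hξ)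
  exact (isInvertible_frame h).contDiffAt_map_inverse.comp y hF

theorem contDiffAt_metric (hf : ContDiffAt ℝ ∞ f y) (hξ : ContDiffAt ℝ ∞ ξ y)
    (h : Function.Bijective (frame f ξ y)) : ContDiffAt ℝ ∞ (metric f ξ) y := by
  have h1 : ContDiffAt ℝ ∞ (fderiv ℝ (fderiv ℝ f)) y :=
    (hf.fderiv_right (m := ∞) (by simp)).fderiv_right (by simp)
  exact ((ContinuousLinearMap.contDiff _).contDiffAt.comp y
    (contDiffAt_const.clm_comp (contDiffAt_split hf hξ h))).clm_comp h1

theorem differentiableAt_metric (hf : ContDiffAt ℝ ∞ f y) (hξ : ContDiffAt ℝ ∞ ξ y)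
    (h : Function.Bijective (frame f ξ y)) : DifferentiableAt ℝ (metric f ξ) y :=
  (contDiffAt_metric hf hξ h).differentiableAt (by simp)

/-- If `V` is decomposed as `f_* τ + σ ξ` near `y`, then the transversal part of `D_X V` is
`h(X, τ) + X σ`. -/
theorem split_fderiv_snd (hf : ContDiffAt ℝ ∞ f y) (hξ : ContDiffAt ℝ ∞ ξ y)
    (h : ∀ᶠ z in 𝓝 y, Function.Bijective (frame f ξ z)) (ht : ∀ X, transversalForm f ξ y X = 0)
    {V : E → Fin (n + 1) → ℝ} (hV : DifferentiableAt ℝ V y) (X : E) :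
    (split f ξ y (fderiv ℝ V y X)).2 =
      metric f ξ y X (split f ξ y (V y)).1 +
        fderiv ℝ (fun z => (split f ξ z (V z)).2) y X := by
  have hy := h.self_of_nhds
  have hs : DifferentiableAt ℝ (fun z => split f ξ z (V z)) y :=
    ((contDiffAt_split hf hξ hy).differentiableAt (by simp)).clm_apply hV
  have hf1 : DifferentiableAt ℝ (fderiv ℝ f) y :=
    (hf.fderiv_right (m := ∞) (by simp)).differentiableAt (by simp)
  have hξ1 : DifferentiableAt ℝ ξ y := hξ.differentiableAt (by simp)
  have e : V =ᶠ[𝓝 y] fun z => fderiv ℝ f z (split f ξ z (V z)).1 +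
      (split f ξ z (V z)).2 • ξ z := by
    filter_upwards [h] with z hz using (fderiv_split_add hz _).symm
  have key := ((hf1.hasFDerivAt.clm_apply hs.hasFDerivAt.fst).add
    (hs.hasFDerivAt.snd.smul hξ1.hasFDerivAt)).congr_of_eventuallyEq e
  have h2 := congrArg (fun L => (split f ξ y (L X)).2) key.fderiv
  have h3 : fderiv ℝ (fun z => (split f ξ z (V z)).2) y X =
      (fderiv ℝ (fun z => split f ξ z (V z)) y X).2 := by
    rw [hs.hasFDerivAt.snd.fderiv]; rfl
  have h4 : (split f ξ y (fderiv ℝ ξ y X)).2 = 0 := ht X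
  rw [h3, metric_apply]
  simpa [split_fderiv hy, split_normal hy, h4] using h2

end Structure

/-! ### The Codazzi equation and total symmetry of the cubic form. -/

section Codazzi

variable {E : Type*} [NormedAddCommGroup E] [NormedSpace ℝ E] {n : ℕ}
  {f ξ : E → Fin (n + 1) → ℝ} {y : E} [FiniteDimensional ℝ E]

omit [FiniteDimensional ℝ E] in
theorem IsBlaschkeNear.eventually_bijective (H : IsBlaschkeNear f ξ y) :
    ∀ᶠ z in 𝓝 y, Function.Bijective (frame f ξ z) :=
  H.mono fun _ h => h.2.2.transversal

theorem IsBlaschkeNear.differentiableAt_metric (H : IsBlaschkeNear f ξ y) :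
    DifferentiableAt ℝ (metric f ξ) y :=
  AffineGeom.differentiableAt_metric H.self_of_nhds.1 H.self_of_nhds.2.1
    H.self_of_nhds.2.2.transversal

theorem fderiv_metric_apply (H : IsBlaschkeNear f ξ y) (X Y Z : E) :
    fderiv ℝ (fun z => metric f ξ z Y Z) y X = fderiv ℝ (metric f ξ) y X Y Z := by
  have h := H.differentiableAt_metric.hasFDerivAt
  rw [((h.clm_apply (hasFDerivAt_const Y y)).clm_apply (hasFDerivAt_const Z y)).fderiv]
  simp

theorem fderiv_metric_symm (H : IsBlaschkeNear f ξ y) (X Y Z : E) :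
    fderiv ℝ (metric f ξ) y X Y Z = fderiv ℝ (metric f ξ) y X Z Y := by
  rw [← fderiv_metric_apply H, ← fderiv_metric_apply H]
  congr 1
  apply Filter.EventuallyEq.fderiv_eq
  filter_upwards [H] with z hz using metric_symm hz.1 Y Z

/-- The Codazzi equation for the affine metric, in terms of constant vector fields. -/
theorem codazzi (H : IsBlaschkeNear f ξ y) (X Y Z : E) :
    fderiv ℝ (metric f ξ) y X Y Z + metric f ξ y X (inducedConnection f ξ y Y Z) =
      fderiv ℝ (metric f ξ) y Y X Z + metric f ξ y Y (inducedConnection f ξ y X Z) := by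
  obtain ⟨hf, hξ, hB⟩ := H.self_of_nhds
  have hf1 : ContDiffAt ℝ ∞ (fderiv ℝ f) y := hf.fderiv_right (by simp)
  have hf2 : DifferentiableAt ℝ (fderiv ℝ (fderiv ℝ f)) y :=
    (hf1.fderiv_right (m := ∞) (by simp)).differentiableAt (by simp)
  -- Take the transversal part of the derivative of D_Y D_Z f. The right side is a third derivative
  -- of `f`, symmetric in X and Y, so exchanging X and Y gives Codazzi.
  have key : ∀ X Y : E, fderiv ℝ (metric f ξ) y X Y Z +
      metric f ξ y X (inducedConnection f ξ y Y Z) =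
      (split f ξ y (fderiv ℝ (fderiv ℝ (fderiv ℝ f)) y X Y Z)).2 := by
    intro X Y
    have hV := (hf2.hasFDerivAt.clm_apply (hasFDerivAt_const Y y)).clm_apply
      (hasFDerivAt_const Z y)
    have h := split_fderiv_snd hf hξ H.eventually_bijective hB.tangential hV.differentiableAt X
    rw [hV.fderiv] at h
    have e : fderiv ℝ (fun z => (split f ξ z (fderiv ℝ (fderiv ℝ f) z Y Z)).2) y X =
      fderiv ℝ (metric f ξ) y X Y Z := fderiv_metric_apply H X Y Z
    rw [e] at h
    rw [add_comm]
    simpa [inducedConnection] using h.symm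
  rw [key, key, (isSymmSndFDerivAt_of_smooth hf1).eq]

/-- Nondegeneracy makes the metric an isomorphism onto the dual space by equality of dimensions, so
`inverse` in `leviCivita` is the true inverse and not its default value. -/
theorem metric_leviCivita (H : IsBlaschkeNear f ξ y) (X Y Z : E) :
    metric f ξ y (leviCivita (metric f ξ) y X Y) Z = koszulForm (metric f ξ) y X Y Z := by
  have hinv : (metric f ξ y).IsInvertible := by
    have hinj : Function.Injective (metric f ξ y) := by
      refine (injective_iff_map_eq_zero _).2 fun X hX => ?_
      exact H.self_of_nhds.2.2.nondegenerate X fun Y => by simp [hX]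
    have hr : Module.finrank ℝ E = Module.finrank ℝ (E →L[ℝ] ℝ) := by
      rw [← (LinearMap.toContinuousLinearMap (𝕜 := ℝ) (E := E) (F' := ℝ)).finrank_eq]
      exact (Subspace.dual_finrank_eq (K := ℝ) (V := E)).symm
    exact ⟨ContinuousLinearEquiv.ofBijective (metric f ξ y) (LinearMap.ker_eq_bot.2 hinj)
      (LinearMap.range_eq_top.2
        ((LinearMap.injective_iff_surjective_of_finrank_eq_finrank hr).1 hinj)), rfl⟩
  rw [leviCivita, hinv.self_apply_inverse]

/-- The cubic form is `-½ ∇ h`. -/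
theorem metric_differenceTensor (H : IsBlaschkeNear f ξ y) (X Y Z : E) :
    metric f ξ y (differenceTensor f ξ y X Y) Z =
      -(1 / 2) * (fderiv ℝ (metric f ξ) y X Y Z
        - metric f ξ y (inducedConnection f ξ y X Y) Z
        - metric f ξ y Y (inducedConnection f ξ y X Z)) := by
  have hf := H.self_of_nhds.1
  rw [differenceTensor, map_sub, sub_apply, metric_leviCivita H]
  -- Codazzi trades the derivatives of h along Y and Z in the Koszul formula for the one along X.
  have c1 := codazzi H X Y Z
  have c2 := codazzi H X Z Y
  have c3 := codazzi H Y Z X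
  rw [fderiv_metric_symm H X Z Y] at c2
  rw [fderiv_metric_symm H Y Z X, fderiv_metric_symm H Z Y X] at c3
  rw [inducedConnection_symm hf Z Y] at c2
  rw [inducedConnection_symm hf Z X, inducedConnection_symm hf Y X] at c3
  rw [metric_symm hf (inducedConnection f ξ y X Y) Z]
  simp only [koszulForm, smul_apply, add_apply, sub_apply, ContinuousLinearMap.flip_apply,
    smul_eq_mul]
  linarith

/-- For the form -½∇h this is the Codazzi equation combined with the symmetry of ∇. The symmetry in
the last two arguments, proved next, is that of h itself. -/
theorem metric_differenceTensor_symm (H : IsBlaschkeNear f ξ y) (X Y Z : E) :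
    metric f ξ y (differenceTensor f ξ y X Y) Z = metric f ξ y (differenceTensor f ξ y Y X) Z := by
  have hf := H.self_of_nhds.1
  have c1 := codazzi H X Y Z
  rw [metric_differenceTensor H, metric_differenceTensor H, inducedConnection_symm hf Y X]
  linarith

theorem metric_differenceTensor_symm_right (H : IsBlaschkeNear f ξ y) (X Y Z : E) :
    metric f ξ y (differenceTensor f ξ y X Y) Z = metric f ξ y (differenceTensor f ξ y X Z) Y := by
  have hf := H.self_of_nhds.1
  rw [metric_differenceTensor H, metric_differenceTensor H, fderiv_metric_symm H X Y Z,
    metric_symm hf (inducedConnection f ξ y X Y), metric_symm hf (inducedConnection f ξ y X Z)]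
  ring

end Codazzi

/-! ### Derivatives of determinants. -/

section Determinant

variable {m : ℕ} {M : ℝ → Matrix (Fin m) (Fin m) ℝ} {M' : Matrix (Fin m) (Fin m) ℝ} {s : ℝ}

/-- Jacobi's formula for the derivative of a determinant. -/
theorem hasDerivAt_det (h : ∀ i j, HasDerivAt (fun t => M t i j) (M' i j) s) :
    HasDerivAt (fun t => (M t).det) ((M s).adjugate * M').trace s := by
  let D : ContinuousMultilinearMap ℝ (fun _ : Fin m => Fin m → ℝ) ℝ :=
    { (Matrix.detRowAlternating (R := ℝ) (n := Fin m)).toMultilinearMap with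
      cont := by
        change Continuous fun A : Matrix (Fin m) (Fin m) ℝ => A.det
        fun_prop }
  have hM : HasDerivAt (fun t => (M t : Fin m → Fin m → ℝ)) M' s :=
    hasDerivAt_pi.2 fun i => hasDerivAt_pi.2 fun j => h i j
  have key := (D.hasFDerivAt (M s)).comp_hasDerivAt s hM
  -- The derivative of a multilinear map replaces one row at a time; by Cramer's rule each resulting
  -- determinant is a pairing with the adjugate.
  have e : D.linearDeriv (M s) M' = ((M s).adjugate * M').trace := by
    refine (ContinuousMultilinearMap.linearDeriv_apply D (M s) M').trans ?_
    change ∑ i, ((M s).updateRow i (M' i)).det = _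
    simp only [← Matrix.cramer_transpose_apply, Matrix.cramer_eq_adjugate_mulVec,
      ← Matrix.adjugate_transpose, Matrix.mulVec, dotProduct, Matrix.transpose_apply, Matrix.trace,
      Matrix.diag, Matrix.mul_apply]
    exact Finset.sum_comm
  rw [e] at key
  exact key

/-- Made for a moving frame: `B` holds the coefficients of the differentiated rows in terms of the
rows. -/
theorem hasDerivAt_det_mul {B : Matrix (Fin m) (Fin m) ℝ}
    (h : ∀ i j, HasDerivAt (fun t => M t i j) ((B * M s) i j) s) :
    HasDerivAt (fun t => (M t).det) (B.trace * (M s).det) s := by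
  convert hasDerivAt_det h using 1
  rw [Matrix.trace_mul_comm, Matrix.mul_assoc, Matrix.mul_adjugate]
  simp [mul_comm]

/-- Made for the Gram matrix of h: the shape P M + M Pᵀ of the derivative is metric compatibility,
with `P` the connection matrix. -/
theorem hasDerivAt_det_gram {P : Matrix (Fin m) (Fin m) ℝ}
    (h : ∀ i j, HasDerivAt (fun t => M t i j) ((P * M s + M s * P.transpose) i j) s) :
    HasDerivAt (fun t => (M t).det) (2 * P.trace * (M s).det) s := by
  convert hasDerivAt_det h using 1
  rw [Matrix.mul_add, Matrix.trace_add, Matrix.trace_mul_comm, Matrix.mul_assoc,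
    Matrix.mul_adjugate, ← Matrix.mul_assoc, Matrix.adjugate_mul]
  simp [mul_comm]
  ring

end Determinant

/-! ### Apolarity, and the volume condition on a basis. -/

section Apolarity

variable {E : Type*} [NormedAddCommGroup E] [NormedSpace ℝ E] {n : ℕ}
  {f ξ : E → Fin (n + 1) → ℝ} {y : E} [FiniteDimensional ℝ E]

theorem IsBlaschkeNear.differentiableAt_metric_apply (H : IsBlaschkeNear f ξ y) (Y Z : E) :
    DifferentiableAt ℝ (fun z => metric f ξ z Y Z) y :=
  (H.differentiableAt_metric.clm_apply (differentiableAt_const Y)).clm_apply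
    (differentiableAt_const Z)

omit [FiniteDimensional ℝ E] in
theorem hasDerivAt_line {F : Type*} [NormedAddCommGroup F] [NormedSpace ℝ F] {g : E → F}
    (hg : DifferentiableAt ℝ g y) (X : E) :
    HasDerivAt (fun t : ℝ => g (y + t • X)) (fderiv ℝ g y X) 0 := by
  have h1 : HasDerivAt (fun t : ℝ => y + t • X) X 0 := by
    simpa using ((hasDerivAt_id (0 : ℝ)).smul_const X).const_add y
  have h2 : HasFDerivAt g (fderiv ℝ g y) (y + (0 : ℝ) • X) := by simpa using hg.hasFDerivAt
  exact h2.comp_hasDerivAt 0 h1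

/-- The matrix with the rows `f_* b₁, …, f_* bₙ, ξ`. -/
noncomputable def frameMatrix (f ξ : E → Fin (n + 1) → ℝ) (X : Fin n → E) (y : E) :
    Matrix (Fin (n + 1)) (Fin (n + 1)) ℝ :=
  Matrix.of (Fin.snoc (α := fun _ => Fin (n + 1) → ℝ) (fun i => fderiv ℝ f y (X i)) (ξ y))

/-- The coordinates of a vector of `ℝⁿ⁺¹` with respect to `f_* b₁, …, f_* bₙ, ξ`. -/
noncomputable def frameCoord (f ξ : E → Fin (n + 1) → ℝ) (b : Module.Basis (Fin n) ℝ E) (y : E)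
    (v : Fin (n + 1) → ℝ) : Fin (n + 1) → ℝ :=
  Fin.snoc (α := fun _ => ℝ) (fun i => b.repr (split f ξ y v).1 i) (split f ξ y v).2

theorem sum_frameCoord (h : Function.Bijective (frame f ξ y)) (b : Module.Basis (Fin n) ℝ E)
    (v : Fin (n + 1) → ℝ) (j : Fin (n + 1)) :
    ∑ k, frameCoord f ξ b y v k * frameMatrix f ξ b y k j = v j := by
  have h1 := congrFun (fderiv_split_add h v) j
  have h2 := congrArg (fun w => fderiv ℝ f y w j) (b.sum_repr (split f ξ y v).1)
  simp only [map_sum, map_smul, Finset.sum_apply, Pi.smul_apply, smul_eq_mul] at h2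
  rw [← h1]
  simp [Fin.sum_univ_castSucc, frameCoord, frameMatrix, h2]

theorem det_frameMatrix_ne_zero (h : Function.Bijective (frame f ξ y))
    (b : Module.Basis (Fin n) ℝ E) : (frameMatrix f ξ b y).det ≠ 0 := by
  have : Matrix.of (fun i => frameCoord f ξ b y (Pi.single i 1)) * frameMatrix f ξ b y = 1 := by
    ext i j
    rw [Matrix.mul_apply]
    simp only [Matrix.of_apply]
    rw [sum_frameCoord h, Matrix.one_eq_pi_single]
  intro h0
  simpa [h0] using congrArg Matrix.det this

/-- The apolarity condition `tr K_X = 0`. -/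
theorem apolarity (H : IsBlaschkeNear f ξ y) (b : Module.Basis (Fin n) ℝ E) (X : E) :
    ∑ i, b.repr (differenceTensor f ξ y X (b i)) i = 0 := by
  obtain ⟨hf, hξ, hB⟩ := H.self_of_nhds
  have hbij := hB.transversal
  have hline : Tendsto (fun t : ℝ => y + t • X) (𝓝 0) (𝓝 y) := by
    have : Continuous fun t : ℝ => y + t • X := by fun_prop
    simpa using this.tendsto 0
  have hf1 : DifferentiableAt ℝ (fderiv ℝ f) y :=
    (hf.fderiv_right (m := ∞) (by simp)).differentiableAt (by simp)
  let V : Fin (n + 1) → Fin (n + 1) → ℝ :=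
    Fin.snoc (α := fun _ => Fin (n + 1) → ℝ) (fun i => fderiv ℝ (fderiv ℝ f) y X (b i))
      (fderiv ℝ ξ y X)
  -- The derivative of the frame f_* b₁, …, f_* bₙ, ξ along X, expanded in that frame. Its trace is
  -- that of ∇_X, because Dξ has no ξ-component.
  let B : Matrix (Fin (n + 1)) (Fin (n + 1)) ℝ := Matrix.of fun i => frameCoord f ξ b y (V i)
  have hM : HasDerivAt (fun t : ℝ => (frameMatrix f ξ b (y + t • X)).det)
      (B.trace * (frameMatrix f ξ b y).det) 0 := by
    have hy : frameMatrix f ξ b y = frameMatrix f ξ b (y + (0 : ℝ) • X) := by simp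
    rw [hy]
    apply hasDerivAt_det_mul
    intro i j
    rw [← hy]
    have e : (B * frameMatrix f ξ b y) i j = V i j := by
      rw [Matrix.mul_apply]; exact sum_frameCoord hbij b (V i) j
    rw [e]
    refine Fin.lastCases ?_ (fun i => ?_) i
    · simp only [frameMatrix, Matrix.of_apply, V, Fin.snoc_last]
      exact hasDerivAt_pi.1 (hasDerivAt_line (hξ.differentiableAt (by simp)) X) j
    · simp only [frameMatrix, Matrix.of_apply, V, Fin.snoc_castSucc]
      have h1 := (hasDerivAt_line hf1 X).clm_apply (hasDerivAt_const (0 : ℝ) (b i))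
      simpa using hasDerivAt_pi.1 h1 j
  -- The matrix of the Levi-Civita connection, written as ∇ - K so that compatibility with h can be
  -- read off from the formula for the cubic form.
  let P : Matrix (Fin n) (Fin n) ℝ := Matrix.of fun i j =>
    b.repr (inducedConnection f ξ y X (b i) - differenceTensor f ξ y X (b i)) j
  let G : E → Matrix (Fin n) (Fin n) ℝ := fun z => Matrix.of fun i j => metric f ξ z (b i) (b j)
  have hG : HasDerivAt (fun t : ℝ => (G (y + t • X)).det) (2 * P.trace * (G y).det) 0 := by
    have hy : G y = G (y + (0 : ℝ) • X) := by simp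
    rw [hy]
    apply hasDerivAt_det_gram
    intro i j
    rw [← hy]
    have hP : ∀ i j, (P * G y) i j = metric f ξ y
        (inducedConnection f ξ y X (b i) - differenceTensor f ξ y X (b i)) (b j) := by
      intro i j
      conv_rhs => rw [← b.sum_repr (inducedConnection f ξ y X (b i) -
        differenceTensor f ξ y X (b i))]
      simp [Matrix.mul_apply, P, G]
    have hP' : (G y * P.transpose) i j = (P * G y) j i := by
      simp only [Matrix.mul_apply, Matrix.transpose_apply, G, Matrix.of_apply]
      exact Finset.sum_congr rfl fun k _ => by rw [metric_symm hf, mul_comm]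
    rw [Matrix.add_apply, hP', hP, hP]
    have h1 := hasDerivAt_line (H.differentiableAt_metric_apply (b i) (b j)) X
    rw [fderiv_metric_apply H] at h1
    have e1 := metric_differenceTensor H X (b i) (b j)
    have e2 := metric_differenceTensor_symm_right H X (b i) (b j)
    rw [metric_symm hf (b i)] at e1
    have hv : metric f ξ y
        (inducedConnection f ξ y X (b i) - differenceTensor f ξ y X (b i)) (b j) + metric f ξ y
        (inducedConnection f ξ y X (b j) - differenceTensor f ξ y X (b j)) (b i) =
        fderiv ℝ (metric f ξ) y X (b i) (b j) := by
      simp only [map_sub, sub_apply]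
      linarith
    rw [hv]
    exact h1
  -- The fourth power of the volume condition, free of square roots and absolute values. Its
  -- logarithmic derivative gives 4 tr B = 4 tr P, that is tr ∇_X = tr ∇̂_X.
  have hEq : (fun t : ℝ => (frameMatrix f ξ b (y + t • X)).det ^ 4) =ᶠ[𝓝 0]
      fun t : ℝ => (G (y + t • X)).det ^ 2 := by
    filter_upwards [hline.eventually H] with t ht
    have := ht.2.2.volume_eq b
    have h2 : (frameMatrix f ξ b (y + t • X)).det ^ 2 = |(G (y + t • X)).det| := by
      rw [← sq_abs]
      exact (congrArg (· ^ 2) this).trans (Real.sq_sqrt (abs_nonneg _))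
    rw [show 4 = 2 * 2 from rfl, pow_mul, h2, sq_abs]
  have hd := (hM.pow 4).unique ((hG.pow 2).congr_of_eventuallyEq hEq)
  have h0 := hEq.self_of_nhds
  have hne := det_frameMatrix_ne_zero hbij b
  simp only [zero_smul, add_zero] at hd h0
  have hBP : B.trace = P.trace := by
    have h3 : 4 * (frameMatrix f ξ b y).det ^ 4 * (B.trace - P.trace) = 0 := by
      push_cast at hd
      linear_combination hd - 4 * P.trace * h0
    have := (mul_eq_zero.1 h3).resolve_left (by positivity)
    linarith
  have hBt : B.trace = ∑ i, b.repr (inducedConnection f ξ y X (b i)) i := by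
    have ht : (split f ξ y (fderiv ℝ ξ y X)).2 = 0 := hB.tangential X
    simp [Matrix.trace, Fin.sum_univ_castSucc, B, V, frameCoord, ht, inducedConnection]
  have hPt : P.trace = ∑ i, b.repr (inducedConnection f ξ y X (b i)) i -
      ∑ i, b.repr (differenceTensor f ξ y X (b i)) i := by
    simp [Matrix.trace, P, Finset.sum_sub_distrib]
  linarith

omit [FiniteDimensional ℝ E] in
/-- The volume condition for one basis implies the volume condition for all families. -/
theorem volume_eq_of_basis (b : Module.Basis (Fin n) ℝ E)
    (h : |(frameMatrix f ξ b y).det| =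
      Real.sqrt |Matrix.det (Matrix.of fun i j => metric f ξ y (b i) (b j))|) (X : Fin n → E) :
    |(frameMatrix f ξ X y).det| =
      Real.sqrt |Matrix.det (Matrix.of fun i j => metric f ξ y (X i) (X j))| := by
  let Q : Matrix (Fin n) (Fin n) ℝ := Matrix.of fun i j => b.repr (X i) j
  have hX : ∀ i, X i = ∑ k, Q i k • b k := fun i => (b.sum_repr (X i)).symm
  have h1 : (Matrix.of fun i j => metric f ξ y (X i) (X j)) =
      Q * (Matrix.of fun i j => metric f ξ y (b i) (b j)) * Q.transpose := by
    ext i j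
    simp only [Matrix.of_apply, Matrix.mul_apply, Matrix.transpose_apply]
    rw [hX i, hX j]
    simp only [map_sum, map_smul, sum_apply, smul_apply, smul_eq_mul,
      Finset.mul_sum, Finset.sum_mul]
    refine Finset.sum_congr rfl fun k _ => Finset.sum_congr rfl fun l _ => by ring
  -- The block matrix diag(Q, 1): the change of vectors leaves the row ξ alone.
  let Q' : Matrix (Fin (n + 1)) (Fin (n + 1)) ℝ := Matrix.of
    (Fin.snoc (α := fun _ => Fin (n + 1) → ℝ)
      (fun i => Fin.snoc (α := fun _ => ℝ) (Q i) 0) (Fin.snoc (α := fun _ => ℝ) 0 1))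
  have h2 : frameMatrix f ξ X y = Q' * frameMatrix f ξ b y := by
    ext i j
    refine Fin.lastCases ?_ (fun i => ?_) i
    · simp [Matrix.mul_apply, frameMatrix, Q', Fin.sum_univ_castSucc]
    · have := congrArg (fun v => fderiv ℝ f y v j) (hX i)
      simpa [Matrix.mul_apply, frameMatrix, Q', Fin.sum_univ_castSucc] using this
  have h3 : Q'.det = Q.det := by
    rw [Matrix.det_succ_row Q' (Fin.last n), Fin.sum_univ_castSucc]
    have : Q'.submatrix (Fin.last n).succAbove (Fin.last n).succAbove = Q := by
      ext i j; simp [Q']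
    rw [this]
    simp [Q', ← two_mul]
  rw [h2, h1, Matrix.det_mul, Matrix.det_mul, Matrix.det_mul, Matrix.det_transpose, h3, abs_mul, h,
    mul_right_comm, abs_mul, ← sq, abs_pow, Real.sqrt_mul (by positivity),
    Real.sqrt_sq (abs_nonneg _)]

end Apolarity

/-! ### Normal form of K and its stabilizers. -/

section Lorentz

variable {E : Type*} [NormedAddCommGroup E] [NormedSpace ℝ E]
  {h : E →L[ℝ] E →L[ℝ] ℝ} {b : Module.Basis (Fin 3) ℝ E}

/-- In the basis `b = (t, v, w)` the symmetric bilinear map `K` has the normal form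
`K(t,t) = l t`, `K(t,v) = -(l/2) v`, `K(t,w) = -(l/2) w`, `K(v,v) = (l/2) t + r v + q w`,
`K(v,w) = q v - r w`, `K(w,w) = (l/2) t - r v - q w`. -/
structure IsNormalForm (K : E →ₗ[ℝ] E →ₗ[ℝ] E) (b : Module.Basis (Fin 3) ℝ E) (l r q : ℝ) :
    Prop where
  eq00 : K (b 0) (b 0) = l • b 0
  eq01 : K (b 0) (b 1) = (-(l / 2)) • b 1
  eq02 : K (b 0) (b 2) = (-(l / 2)) • b 2
  eq10 : K (b 1) (b 0) = (-(l / 2)) • b 1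
  eq20 : K (b 2) (b 0) = (-(l / 2)) • b 2
  eq11 : K (b 1) (b 1) = (l / 2) • b 0 + r • b 1 + q • b 2
  eq12 : K (b 1) (b 2) = q • b 1 - r • b 2
  eq21 : K (b 2) (b 1) = q • b 1 - r • b 2
  eq22 : K (b 2) (b 2) = (l / 2) • b 0 - r • b 1 - q • b 2

theorem sum_repr_three (b : Module.Basis (Fin 3) ℝ E) (v : E) :
    v = b.repr v 0 • b 0 + b.repr v 1 • b 1 + b.repr v 2 • b 2 := by
  conv_lhs => rw [← b.sum_repr v]
  rw [Fin.sum_univ_three]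

theorem IsLorentzONB.apply_basis (hb : IsLorentzONB h b) (v : E) :
    h v (b 0) = -b.repr v 0 ∧ h v (b 1) = b.repr v 1 ∧ h v (b 2) = b.repr v 2 := by
  have h0 := hb
  simp only [IsLorentzONB] at h0
  refine ⟨?_, ?_, ?_⟩ <;> conv_lhs => rw [sum_repr_three b v]
  all_goals simp [h0]

theorem IsLorentzONB.expand (hb : IsLorentzONB h b) (v : E) :
    v = (-h v (b 0)) • b 0 + h v (b 1) • b 1 + h v (b 2) • b 2 := by
  obtain ⟨h0, h1, h2⟩ := hb.apply_basis v
  rw [h0, h1, h2, neg_neg, ← sum_repr_three]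

theorem IsLorentzONB.apply_apply (hb : IsLorentzONB h b) (v w : E) :
    h v w = -(b.repr v 0 * b.repr w 0) + b.repr v 1 * b.repr w 1 + b.repr v 2 * b.repr w 2 := by
  obtain ⟨h0, h1, h2⟩ := hb.apply_basis v
  conv_lhs => rw [sum_repr_three b w]
  simp [h0, h1, h2]
  ring

/-- The normal form of an apolar totally symmetric cubic form that is symmetric under the
rotations of order three about `b 0`. -/
theorem IsLorentzONB.isNormalForm (hb : IsLorentzONB h b) {K : E →ₗ[ℝ] E →ₗ[ℝ] E}
    (hs : ∀ X Y Z, h (K X Y) Z = h (K Y X) Z) (hs' : ∀ X Y Z, h (K X Y) Z = h (K X Z) Y)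
    (h1 : h (K (b 0) (b 0)) (b 1) = 0) (h2 : h (K (b 0) (b 0)) (b 2) = 0)
    (h12 : h (K (b 0) (b 1)) (b 2) = 0)
    (h11 : h (K (b 0) (b 1)) (b 1) = h (K (b 0) (b 2)) (b 2))
    (t0 : -h (K (b 0) (b 0)) (b 0) + h (K (b 0) (b 1)) (b 1) + h (K (b 0) (b 2)) (b 2) = 0)
    (t1 : h (K (b 1) (b 1)) (b 1) + h (K (b 1) (b 2)) (b 2) = 0)
    (t2 : h (K (b 2) (b 1)) (b 1) + h (K (b 2) (b 2)) (b 2) = 0) :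
    IsNormalForm K b (-h (K (b 0) (b 0)) (b 0)) (h (K (b 1) (b 1)) (b 1))
      (h (K (b 1) (b 1)) (b 2)) := by
  have a1 : h (K (b 0) (b 1)) (b 0) = 0 := by rw [hs', h1]
  have a2 : h (K (b 0) (b 2)) (b 0) = 0 := by rw [hs', h2]
  have a3 : h (K (b 0) (b 2)) (b 1) = 0 := by rw [hs', h12]
  have a4 : h (K (b 0) (b 1)) (b 1) = -(-h (K (b 0) (b 0)) (b 0) / 2) := by linarith
  have a5 : h (K (b 0) (b 2)) (b 2) = -(-h (K (b 0) (b 0)) (b 0) / 2) := by linarith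
  have a6 : h (K (b 1) (b 1)) (b 0) = -(-h (K (b 0) (b 0)) (b 0) / 2) := by
    rw [hs', hs, a4]
  have a7 : h (K (b 1) (b 2)) (b 0) = 0 := by rw [hs', hs, h12]
  have a8 : h (K (b 2) (b 2)) (b 0) = -(-h (K (b 0) (b 0)) (b 0) / 2) := by
    rw [hs', hs, a5]
  have a9 : h (K (b 1) (b 2)) (b 1) = h (K (b 1) (b 1)) (b 2) := hs' _ _ _
  have a10 : h (K (b 1) (b 2)) (b 2) = -h (K (b 1) (b 1)) (b 1) := by linarith
  have a11 : h (K (b 2) (b 2)) (b 1) = -h (K (b 1) (b 1)) (b 1) := by rw [hs', hs, a10]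
  have a12 : h (K (b 2) (b 2)) (b 2) = -h (K (b 1) (b 1)) (b 2) := by
    have := hs (b 2) (b 1) (b 1)
    linarith
  have sw : ∀ X Y, K X Y = K Y X := fun X Y => by
    rw [hb.expand (K X Y), hb.expand (K Y X), hs X Y (b 0), hs X Y (b 1), hs X Y (b 2)]
  have e01 := hb.expand (K (b 0) (b 1))
  have e02 := hb.expand (K (b 0) (b 2))
  have e12 := hb.expand (K (b 1) (b 2))
  rw [a1, a4, h12] at e01
  rw [a2, a3, a5] at e02
  rw [a7, a9, a10] at e12
  refine ⟨?_, ?_, ?_, ?_, ?_, ?_, ?_, ?_, ?_⟩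
  · have e := hb.expand (K (b 0) (b 0))
    rw [h1, h2] at e
    linear_combination (norm := module) e
  · linear_combination (norm := module) e01
  · linear_combination (norm := module) e02
  · rw [sw]; linear_combination (norm := module) e01
  · rw [sw]; linear_combination (norm := module) e02
  · have e := hb.expand (K (b 1) (b 1))
    rw [a6] at e
    linear_combination (norm := module) e
  · linear_combination (norm := module) e12
  · rw [sw]; linear_combination (norm := module) e12
  · have e := hb.expand (K (b 2) (b 2))
    rw [a8, a11, a12] at e
    linear_combination (norm := module) e

theorem toLin_rotation (s : ℝ) :
    Matrix.toLin b b (rotationMatrix s) (b 0) = b 0 ∧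
    Matrix.toLin b b (rotationMatrix s) (b 1) = Real.cos s • b 1 + Real.sin s • b 2 ∧
    Matrix.toLin b b (rotationMatrix s) (b 2) = (-Real.sin s) • b 1 + Real.cos s • b 2 := by
  refine ⟨?_, ?_, ?_⟩ <;> simp [Matrix.toLin_self, Fin.sum_univ_three, rotationMatrix]

theorem IsLorentzONB.rotation_preserves (hb : IsLorentzONB h b) (s : ℝ) (X Y : E) :
    h (Matrix.toLin b b (rotationMatrix s) X) (Matrix.toLin b b (rotationMatrix s) Y) = h X Y := by
  have h0 := hb
  simp only [IsLorentzONB] at h0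
  obtain ⟨r0, r1, r2⟩ := toLin_rotation (b := b) s
  rw [sum_repr_three b X, sum_repr_three b Y]
  simp [r0, r1, r2, h0]
  linear_combination (b.repr X 1 * b.repr Y 1 + b.repr X 2 * b.repr Y 2) *
    Real.sin_sq_add_cos_sq s

/-- The terms with l are invariant under all rotations about `b 0`. The terms with r and q form a
trace-free binary cubic, which a rotation by s turns by 3s; it is fixed only if it is zero or 3s is
a multiple of 2π. -/
theorem IsNormalForm.rotation_preserves_iff {K : E →ₗ[ℝ] E →ₗ[ℝ] E} {l r q : ℝ}
    (hK : IsNormalForm K b l r q) (s : ℝ) :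
    (∀ X Y, K (Matrix.toLin b b (rotationMatrix s) X) (Matrix.toLin b b (rotationMatrix s) Y) =
      Matrix.toLin b b (rotationMatrix s) (K X Y)) ↔
      (r = 0 ∧ q = 0) ∨ Real.cos (3 * s) = 1 := by
  obtain ⟨r0, r1, r2⟩ := toLin_rotation (b := b) s
  have hcs := Real.sin_sq_add_cos_sq s
  have h3 : Real.cos (3 * s) = 4 * Real.cos s ^ 3 - 3 * Real.cos s := Real.cos_three_mul s
  set L := Matrix.toLin b b (rotationMatrix s)
  set c := Real.cos s
  set d := Real.sin s
  -- With z = c + id and |z| = 1, this is |z² - z̄|² = |z³ - 1|² = 2 - 2 cos 3s. The equations `f1`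
  -- and `f2` below are the real and imaginary parts of (r - iq)(z² - z̄) = 0.
  have hg : (c ^ 2 - d ^ 2 - c) ^ 2 + (2 * c * d + d) ^ 2 = 2 - 2 * Real.cos (3 * s) := by
    rw [h3]
    linear_combination (c ^ 2 + d ^ 2 + 2 + 6 * c) * hcs
  constructor
  · intro H
    have H11 := H (b 1) (b 1)
    rw [hK.eq11] at H11
    simp only [map_add, map_smul, r0, r1, r2, LinearMap.add_apply, LinearMap.smul_apply, hK.eq11,
      hK.eq12, hK.eq21, hK.eq22] at H11
    have e1 := congrArg (fun v => b.repr v 1) H11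
    have e2 := congrArg (fun v => b.repr v 2) H11
    simp at e1 e2
    have f1 : r * (c ^ 2 - d ^ 2 - c) + q * (2 * c * d + d) = 0 := by linear_combination e1
    have f2 : q * (c ^ 2 - d ^ 2 - c) - r * (2 * c * d + d) = 0 := by linear_combination e2
    have f3 : (r ^ 2 + q ^ 2) * (2 - 2 * Real.cos (3 * s)) = 0 := by
      rw [← hg]
      linear_combination (r * (c ^ 2 - d ^ 2 - c) + q * (2 * c * d + d)) * f1 +
        (q * (c ^ 2 - d ^ 2 - c) - r * (2 * c * d + d)) * f2
    rcases mul_eq_zero.1 f3 with h | h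
    · left
      constructor <;> nlinarith [sq_nonneg r, sq_nonneg q]
    · right; linarith
  · intro H
    have key : r * (c ^ 2 - d ^ 2 - c) + q * (2 * c * d + d) = 0 ∧
        q * (c ^ 2 - d ^ 2 - c) - r * (2 * c * d + d) = 0 := by
      rcases H with ⟨rfl, rfl⟩ | H
      · simp
      · have g : (c ^ 2 - d ^ 2 - c) ^ 2 + (2 * c * d + d) ^ 2 = 0 := by
          rw [hg, H]; norm_num
        have g1 : c ^ 2 - d ^ 2 - c = 0 := by nlinarith [sq_nonneg (2 * c * d + d)]
        have g2 : 2 * c * d + d = 0 := by nlinarith [sq_nonneg (2 * c * d + d)]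
        rw [g1, g2]; simp
    obtain ⟨k1, k2⟩ := key
    have : K.compl₁₂ L L = K.compr₂ L := by
      refine b.ext fun i => b.ext fun j => ?_
      rw [LinearMap.compl₁₂_apply, LinearMap.compr₂_apply]
      fin_cases i <;> fin_cases j <;>
        simp only [Fin.zero_eta, Fin.mk_one, Fin.reduceFinMk, map_add, map_sub, map_smul, r0, r1,
          r2, LinearMap.add_apply, LinearMap.smul_apply, hK.eq00, hK.eq01, hK.eq02, hK.eq10,
          hK.eq20, hK.eq11, hK.eq12, hK.eq21, hK.eq22]
      · module
      · module
      · module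
      · linear_combination (norm := module) k1 • b 1 + k2 • b 2 + ((l / 2) • hcs) • b 0
      · linear_combination (norm := module) k2 • b 1 - k1 • b 2
      · module
      · linear_combination (norm := module) k2 • b 1 - k1 • b 2
      · linear_combination (norm := module) -(k1 • b 1) - k2 • b 2 + ((l / 2) • hcs) • b 0
    exact fun X Y => congrArg (fun B => B X Y) this

/-- If `K(t,t) ≠ 0`, then a linear map that preserves the Lorentz metric and `K` fixes `t`. -/
theorem IsNormalForm.map_eq_of_preserves (hb : IsLorentzONB h b) {K : E →ₗ[ℝ] E →ₗ[ℝ] E}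
    {l r q : ℝ} (hK : IsNormalForm K b l r q) (hl : l ≠ 0) {L : E →ₗ[ℝ] E}
    (hL : ∀ X Y, h (L X) (L Y) = h X Y) (hLK : ∀ X Y, K (L X) (L Y) = L (K X Y)) :
    L (b 0) = b 0 := by
  have h1 := hLK (b 0) (b 0)
  have h2 := hL (b 0) (b 0)
  have h3 := sum_repr_three b (L (b 0))
  rw [hb.apply_apply, hb.apply_apply] at h2
  set x := b.repr (L (b 0)) 0
  set u := b.repr (L (b 0)) 1
  set v := b.repr (L (b 0)) 2
  rw [hK.eq00, map_smul] at h1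
  have e0 : b.repr (K (L (b 0)) (L (b 0))) 0 = l * (x ^ 2 + (u ^ 2 + v ^ 2) / 2) := by
    rw [h3]
    simp [hK.eq00, hK.eq01, hK.eq02, hK.eq10, hK.eq20, hK.eq11, hK.eq12, hK.eq21, hK.eq22]
    ring
  rw [h1] at e0
  have e1 : l * x = l * (x ^ 2 + (u ^ 2 + v ^ 2) / 2) := by simpa [x] using e0
  have e2 := mul_left_cancel₀ hl e1
  have h4 : x ^ 2 = 1 + u ^ 2 + v ^ 2 := by
    simp at h2
    linarith
  -- Eliminating u² + v² gives (3x + 1)(x - 1) = 0, and x² ≥ 1 rules out -1/3.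
  have hx : x = 1 := by nlinarith [sq_nonneg u, sq_nonneg v]
  rw [hx] at h4
  have hu : u = 0 := by nlinarith [sq_nonneg u, sq_nonneg v]
  have hv : v = 0 := by nlinarith [sq_nonneg u, sq_nonneg v]
  rw [h3, hx, hu, hv]
  simp

theorem mem_groupSO2 {A : Matrix.SpecialLinearGroup (Fin 3) ℝ} :
    A ∈ groupSO2 ↔ ∃ s, A.1 = rotationMatrix s := by
  constructor
  · rintro ⟨s, rfl⟩
    exact ⟨s.toAdd, rfl⟩
  · rintro ⟨s, hs⟩
    exact ⟨Multiplicative.ofAdd s, Subtype.ext hs.symm⟩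

/-- The multiples of 2π/3 are exactly the solutions of cos 3s = 1, the form in which the stabilizer
condition appears. -/
theorem mem_groupZ3 {A : Matrix.SpecialLinearGroup (Fin 3) ℝ} :
    A ∈ groupZ3 ↔ ∃ s, A.1 = rotationMatrix s ∧ Real.cos (3 * s) = 1 := by
  have hpow : ∀ k : ℤ, rotation (Multiplicative.ofAdd (2 * Real.pi / 3)) ^ k =
      rotation (Multiplicative.ofAdd (k * (2 * Real.pi / 3))) := fun k => by
    rw [← map_zpow, ← ofAdd_zsmul, zsmul_eq_mul]
  constructor
  · rintro ⟨k, rfl⟩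
    refine ⟨k * (2 * Real.pi / 3), ?_, ?_⟩
    · change ((rotation _) ^ k).1 = _
      rw [hpow]
      rfl
    · rw [show 3 * ((k : ℝ) * (2 * Real.pi / 3)) = k * (2 * Real.pi) by ring]
      exact Real.cos_int_mul_two_pi k
  · rintro ⟨s, hs, hc⟩
    obtain ⟨k, hk⟩ := (Real.cos_eq_one_iff _).1 hc
    refine ⟨k, ?_⟩
    change (rotation _) ^ k = _
    rw [hpow]
    have : (k : ℝ) * (2 * Real.pi / 3) = s := by linarith
    rw [this]
    exact Subtype.ext hs.symm

theorem groupZ3_le_groupSO2 : groupZ3 ≤ groupSO2 := fun _ hA =>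
  let ⟨s, hs, _⟩ := mem_groupZ3.1 hA
  mem_groupSO2.2 ⟨s, hs⟩

/-- An isometry fixing the timelike vector acts orthogonally on its complement, and determinant one
makes that action a rotation. -/
theorem IsLorentzONB.mem_groupSO2_of_fixes (hb : IsLorentzONB h b)
    {A : Matrix.SpecialLinearGroup (Fin 3) ℝ}
    (hL : ∀ X Y, h (Matrix.toLin b b A.1 X) (Matrix.toLin b b A.1 Y) = h X Y)
    (h0 : Matrix.toLin b b A.1 (b 0) = b 0) : A ∈ groupSO2 := by
  have hc : ∀ i j, b.repr (Matrix.toLin b b A.1 (b j)) i = A.1 i j := fun i j => by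
    rw [Matrix.toLin_self]; simp [Finsupp.single_apply]
  have a00 : A.1 0 0 = 1 := by rw [← hc, h0]; simp
  have a10 : A.1 1 0 = 0 := by rw [← hc, h0]; simp
  have a20 : A.1 2 0 = 0 := by rw [← hc, h0]; simp
  have e : ∀ i j, h (b i) (b j) = -(A.1 0 i * A.1 0 j) + A.1 1 i * A.1 1 j + A.1 2 i * A.1 2 j :=
    fun i j => by rw [← hL, hb.apply_apply]; simp only [hc]
  have hb' := hb
  simp only [IsLorentzONB] at hb'
  have e01 := e 0 1
  have e02 := e 0 2
  have e11 := e 1 1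
  have e12 := e 1 2
  have e22 := e 2 2
  simp [hb', a00, a10, a20] at e01 e02
  simp [hb', e01, e02] at e11 e12 e22
  have hd := A.2
  rw [Matrix.det_fin_three] at hd
  simp only [a00, a10, a20, e01, e02] at hd
  have p1 : A.1 2 2 = A.1 1 1 := by
    linear_combination A.1 1 1 * hd + A.1 2 2 * e11 - A.1 2 1 * e12
  have p2 : A.1 1 2 = -A.1 2 1 := by
    linear_combination -A.1 2 1 * hd + A.1 1 2 * e11 - A.1 1 1 * e12
  have p3 : A.1 1 1 ^ 2 + A.1 2 1 ^ 2 = 1 := by linear_combination -e11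
  obtain ⟨s, hs1, hs2⟩ : ∃ s, A.1 1 1 = Real.cos s ∧ A.1 2 1 = Real.sin s := by
    -- The angle is the argument of the unit complex number given by the image of `b 1`.
    have hz : ‖(⟨A.1 1 1, A.1 2 1⟩ : ℂ)‖ = 1 := by
      rw [← sq_eq_sq₀ (norm_nonneg _) zero_le_one, Complex.sq_norm, Complex.normSq_mk]
      linarith
    have hz0 : (⟨A.1 1 1, A.1 2 1⟩ : ℂ) ≠ 0 := fun h => by simp [h] at hz
    refine ⟨Complex.arg ⟨A.1 1 1, A.1 2 1⟩, ?_, ?_⟩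
    · rw [Complex.cos_arg hz0, hz, div_one]
    · rw [Complex.sin_arg, hz, div_one]
  refine mem_groupSO2.2 ⟨s, ?_⟩
  ext i j
  fin_cases i <;> fin_cases j <;>
    simp [rotationMatrix, a00, a10, a20, e01, e02, p1, p2, hs1, hs2]

/-- The stabilizers of the normal form. -/
theorem IsNormalForm.stabilizer (hb : IsLorentzONB h b) {K : E →ₗ[ℝ] E →ₗ[ℝ] E} {l r q : ℝ}
    (hK : IsNormalForm K b l r q) {S : E → E} {c : ℝ} (hS : ∀ X, S X = c • X)
    {G : Set (Matrix.SpecialLinearGroup (Fin 3) ℝ)}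
    (hG : G = {A | (∀ X Y, h (Matrix.toLin b b A.1 X) (Matrix.toLin b b A.1 Y) = h X Y) ∧
      (∀ X Y, K (Matrix.toLin b b A.1 X) (Matrix.toLin b b A.1 Y) =
        Matrix.toLin b b A.1 (K X Y)) ∧
      ∀ X, S (Matrix.toLin b b A.1 X) = Matrix.toLin b b A.1 (S X)}) :
    (G ∩ groupSO2 = groupZ3 ∨ G ∩ groupSO2 = groupSO2) ∧
      (K (b 0) (b 0) ≠ 0 → G ⊆ groupSO2) := by
  have hmem : ∀ {A : Matrix.SpecialLinearGroup (Fin 3) ℝ} {s : ℝ}, A.1 = rotationMatrix s →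
      (A ∈ G ↔ (r = 0 ∧ q = 0) ∨ Real.cos (3 * s) = 1) := by
    intro A s hA
    rw [← hK.rotation_preserves_iff s, hG, Set.mem_ofPred_eq, hA]
    refine ⟨fun H => H.2.1, fun H => ⟨hb.rotation_preserves s, H, fun X => ?_⟩⟩
    rw [hS, hS, map_smul]
  constructor
  · by_cases h0 : r = 0 ∧ q = 0
    · right
      refine Set.inter_eq_right.2 fun A hA => ?_
      obtain ⟨s, hs⟩ := mem_groupSO2.1 hA
      exact (hmem hs).2 (Or.inl h0)
    · left
      ext A
      constructor
      · rintro ⟨hA, hA'⟩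
        obtain ⟨s, hs⟩ := mem_groupSO2.1 hA'
        exact mem_groupZ3.2 ⟨s, hs, ((hmem hs).1 hA).resolve_left h0⟩
      · intro hA
        obtain ⟨s, hs, hc⟩ := mem_groupZ3.1 hA
        exact ⟨(hmem hs).2 (Or.inr hc), groupZ3_le_groupSO2 hA⟩
  · intro h0 A hA
    rw [hG] at hA
    have hl : l ≠ 0 := fun hl => h0 (by rw [hK.eq00, hl, zero_smul])
    exact hb.mem_groupSO2_of_fixes hA.1 (hK.map_eq_of_preserves hb hl hA.1 hA.2.1)

end Lorentz

/-! ### First and second derivatives of the warped map. -/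

section Warp

/-- The inclusion `v ↦ (0, v)`. -/
noncomputable def inc : (Fin 3 → ℝ) →L[ℝ] (Fin 4 → ℝ) :=
  ContinuousLinearMap.pi (Fin.cons 0 fun i => ContinuousLinearMap.proj i)

/-- The first standard basis vector of `ℝ⁴`. -/
def north : Fin 4 → ℝ := Matrix.vecCons 1 0

theorem inc_zero (v : Fin 3 → ℝ) : inc v 0 = 0 := rfl

theorem inc_succ (v : Fin 3 → ℝ) (i : Fin 3) : inc v i.succ = v i := rfl

theorem north_zero : north 0 = 1 := rfl

theorem north_succ (i : Fin 3) : north i.succ = 0 := rfl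

theorem smul_north_add_inc_inj {a b : ℝ} {v w : Fin 3 → ℝ}
    (h : a • north + inc v = b • north + inc w) : a = b ∧ v = w := by
  constructor
  · simpa [north_zero, inc_zero] using congrFun h 0
  · ext i
    simpa [north_succ, inc_succ] using congrFun h i.succ

variable {V : Type*} [NormedAddCommGroup V] [NormedSpace ℝ V]
  {γ₁ γ₂ : ℝ → ℝ} {ψ : V → Fin 3 → ℝ} {ε t : ℝ} {u : V}

theorem warp_eq {N : Type*} (γ₁ γ₂ : ℝ → ℝ) (φ : N → Fin 3 → ℝ) (x : ℝ × N) :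
    warp γ₁ γ₂ φ x = γ₁ x.1 • north + γ₂ x.1 • inc (φ x.2) := by
  ext i
  refine Fin.cases ?_ (fun i => ?_) i
  · simp [warp, north_zero, inc_zero]
  · simp [warp, north_succ, inc_succ]

theorem hasFDerivAt_warp (h₁ : DifferentiableAt ℝ γ₁ t) (h₂ : DifferentiableAt ℝ γ₂ t)
    (hψ : DifferentiableAt ℝ ψ u) :
    HasFDerivAt (warp γ₁ γ₂ ψ)
      ((((ContinuousLinearMap.fst ℝ ℝ V).smulRight (deriv γ₁ t • north)) +
        (γ₂ t • inc.comp ((fderiv ℝ ψ u).comp (ContinuousLinearMap.snd ℝ ℝ V)) +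
        (ContinuousLinearMap.fst ℝ ℝ V).smulRight (deriv γ₂ t • inc (ψ u)))) :
          ℝ × V →L[ℝ] Fin 4 → ℝ) (t, u) := by
  have e : warp γ₁ γ₂ ψ = fun x : ℝ × V => γ₁ x.1 • north + γ₂ x.1 • inc (ψ x.2) :=
    funext fun x => warp_eq γ₁ γ₂ ψ x
  have d₁ : HasFDerivAt (fun x : ℝ × V => γ₁ x.1) _ (t, u) :=
    (h₁.hasDerivAt.hasFDerivAt).comp (t, u) hasFDerivAt_fst
  have d₂ : HasFDerivAt (fun x : ℝ × V => γ₂ x.1) _ (t, u) :=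
    (h₂.hasDerivAt.hasFDerivAt).comp (t, u) hasFDerivAt_fst
  have d₃ : HasFDerivAt (fun x : ℝ × V => inc (ψ x.2)) _ (t, u) :=
    inc.hasFDerivAt.comp (t, u) ((hψ.hasFDerivAt).comp (t, u) hasFDerivAt_snd)
  rw [e]
  refine ((d₁.smul_const north).add (d₂.smul d₃)).congr_fderiv ?_
  ext x i <;> simp

theorem fderiv_warp_apply (h₁ : DifferentiableAt ℝ γ₁ t) (h₂ : DifferentiableAt ℝ γ₂ t)
    (hψ : DifferentiableAt ℝ ψ u) (s : ℝ) (X : V) :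
    fderiv ℝ (warp γ₁ γ₂ ψ) (t, u) (s, X) = (deriv γ₁ t * s) • north +
      inc ((deriv γ₂ t * s) • ψ u + γ₂ t • fderiv ℝ ψ u X) := by
  rw [(hasFDerivAt_warp h₁ h₂ hψ).fderiv]
  simp
  module

theorem eventually_differentiableAt {A B : Type*} [NormedAddCommGroup A] [NormedSpace ℝ A]
    [NormedAddCommGroup B] [NormedSpace ℝ B] {g : A → B} {a : A} (hg : ContDiffAt ℝ ∞ g a) :
    ∀ᶠ z in 𝓝 a, DifferentiableAt ℝ g z :=
  ((hg.of_le (by simp : (1 : WithTop ℕ∞) ≤ ∞)).eventually (by simp)).mono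
    fun _ hz => hz.differentiableAt (by simp)

theorem contDiffAt_deriv {γ : ℝ → ℝ} {t : ℝ} (h : ContDiffAt ℝ ∞ γ t) :
    ContDiffAt ℝ ∞ (deriv γ) t :=
  (h.fderiv_right (m := ∞) (by simp)).clm_apply contDiffAt_const

theorem contDiffAt_warp (h₁ : ContDiffAt ℝ ∞ γ₁ t) (h₂ : ContDiffAt ℝ ∞ γ₂ t)
    (hψ : ContDiffAt ℝ ∞ ψ u) : ContDiffAt ℝ ∞ (warp γ₁ γ₂ ψ) (t, u) := by
  have e : warp γ₁ γ₂ ψ = fun x : ℝ × V => γ₁ x.1 • north + γ₂ x.1 • inc (ψ x.2) :=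
    funext fun x => warp_eq γ₁ γ₂ ψ x
  rw [e]
  exact ((h₁.comp (t, u) contDiffAt_fst).smul contDiffAt_const).add
    ((h₂.comp (t, u) contDiffAt_fst).smul
      (inc.contDiff.contDiffAt.comp (t, u) (hψ.comp (t, u) contDiffAt_snd)))

theorem fderiv_fderiv_warp_apply (h₁ : ContDiffAt ℝ ∞ γ₁ t) (h₂ : ContDiffAt ℝ ∞ γ₂ t)
    (hψ : ContDiffAt ℝ ∞ ψ u) (s r : ℝ) (X Y : V) :
    fderiv ℝ (fderiv ℝ (warp γ₁ γ₂ ψ)) (t, u) (s, X) (r, Y) =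
      (deriv (deriv γ₁) t * s * r) • north +
      inc ((deriv (deriv γ₂) t * s * r) • ψ u + (deriv γ₂ t * r) • fderiv ℝ ψ u X +
        (deriv γ₂ t * s) • fderiv ℝ ψ u Y + γ₂ t • fderiv ℝ (fderiv ℝ ψ) u X Y) := by
  have d₁ : DifferentiableAt ℝ (deriv γ₁) t := (contDiffAt_deriv h₁).differentiableAt (by simp)
  have d₂ : DifferentiableAt ℝ (deriv γ₂) t := (contDiffAt_deriv h₂).differentiableAt (by simp)
  have dψ : HasFDerivAt (fderiv ℝ ψ) _ u :=
    ((hψ.fderiv_right (m := ∞) (by simp)).differentiableAt (by simp)).hasFDerivAt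
  have dY : HasFDerivAt (fun z => fderiv ℝ ψ z Y) _ u := dψ.clm_apply (hasFDerivAt_const Y u)
  have dF : HasFDerivAt (fderiv ℝ (warp γ₁ γ₂ ψ)) _ (t, u) :=
    (((contDiffAt_warp h₁ h₂ hψ).fderiv_right (m := ∞) (by simp)).differentiableAt
      (by simp)).hasFDerivAt
  -- In a fixed direction the first derivative is again a sum of two warped maps, so the first-order
  -- formula can be applied a second time.
  have e : (fun z => fderiv ℝ (warp γ₁ γ₂ ψ) z (r, Y)) =ᶠ[𝓝 (t, u)] fun z =>
      warp (fun s => deriv γ₁ s * r) (fun s => deriv γ₂ s * r) ψ z +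
        warp (fun _ => 0) γ₂ (fun z => fderiv ℝ ψ z Y) z := by
    filter_upwards [continuousAt_fst.eventually (eventually_differentiableAt h₁),
      continuousAt_fst.eventually (eventually_differentiableAt h₂),
      continuousAt_snd.eventually (eventually_differentiableAt hψ)] with z z₁ z₂ z₃
    rw [show z = (z.1, z.2) from rfl, fderiv_warp_apply z₁ z₂ z₃, warp_eq, warp_eq]
    simp
    module
  have k₁ := hasFDerivAt_warp (d₁.mul_const r) (d₂.mul_const r) (hψ.differentiableAt (by simp))
  have k₂ := hasFDerivAt_warp (differentiableAt_const (0 : ℝ)) (h₂.differentiableAt (by simp))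
    dY.differentiableAt
  have k := ((k₁.add k₂).congr_of_eventuallyEq e).unique
    (dF.clm_apply (hasFDerivAt_const (r, Y) (t, u)))
  have k' := congrArg (fun L => L (s, X)) k
  rw [dY.fderiv] at k'
  simp [d₁, d₂] at k'
  rw [← k']
  simp
  module

end Warp

/-! ### The affine metric of a warped surface. -/

section WarpMetric

variable {V : Type*} [NormedAddCommGroup V] [NormedSpace ℝ V]
  {γ₁ γ₂ : ℝ → ℝ} {ψ : V → Fin 3 → ℝ} {ε t : ℝ} {u : V}

/-- At the point `(t, u)` the curve `γ` and the surface `ψ` are smooth, and `-ε ψ` is the affine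
normal of `ψ`. -/
structure IsWarpDatum (γ₁ γ₂ : ℝ → ℝ) (ψ : V → Fin 3 → ℝ) (ε t : ℝ) (u : V) : Prop where
  smooth₁ : ContDiffAt ℝ ∞ γ₁ t
  smooth₂ : ContDiffAt ℝ ∞ γ₂ t
  smooth : ContDiffAt ℝ ∞ ψ u
  sign : ε = 1 ∨ ε = -1
  blaschke : IsBlaschkeNormalAt ψ (fun q => -(ε • ψ q)) u

/-- The Wronskian `γ₁' γ₂'' - γ₁'' γ₂'`. -/
noncomputable def wronskian (γ₁ γ₂ : ℝ → ℝ) (t : ℝ) : ℝ :=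
  deriv γ₁ t * deriv (deriv γ₂) t - deriv (deriv γ₁) t * deriv γ₂ t

/-- The transversal component of the vector `(0, ψ)` with respect to `ξ`. -/
noncomputable def radial (γ₁ γ₂ : ℝ → ℝ) (ψ : V → Fin 3 → ℝ) (ξ : ℝ × V → Fin 4 → ℝ)
    (z : ℝ × V) : ℝ :=
  (split (warp γ₁ γ₂ ψ) ξ z (inc (ψ z.2))).2

theorem IsWarpDatum.fderiv_apply (H : IsWarpDatum γ₁ γ₂ ψ ε t u) (s : ℝ) (X : V) :
    fderiv ℝ (warp γ₁ γ₂ ψ) (t, u) (s, X) = (deriv γ₁ t * s) • north +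
      inc ((deriv γ₂ t * s) • ψ u + γ₂ t • fderiv ℝ ψ u X) :=
  fderiv_warp_apply (H.smooth₁.differentiableAt (by simp)) (H.smooth₂.differentiableAt (by simp))
    (H.smooth.differentiableAt (by simp)) s X

variable [FiniteDimensional ℝ V] {ξ : ℝ × V → Fin 4 → ℝ}

/-- The normal -εψ in the Gauss formula of ψ is radial. This and the two following formulas express
second derivatives modulo tangent vectors as multiples of (0, ψ); taking ξ-components then yields
the metric. -/
theorem IsWarpDatum.second_vv (H : IsWarpDatum γ₁ γ₂ ψ ε t u) (X Y : V) :
    fderiv ℝ (fderiv ℝ (warp γ₁ γ₂ ψ)) (t, u) (0, X) (0, Y) =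
      fderiv ℝ (warp γ₁ γ₂ ψ) (t, u) (0, inducedConnection ψ (fun q => -(ε • ψ q)) u X Y) +
        (-(ε * γ₂ t * metric ψ (fun q => -(ε • ψ q)) u X Y)) • inc (ψ u) := by
  rw [fderiv_fderiv_warp_apply H.smooth₁ H.smooth₂ H.smooth, H.fderiv_apply,
    gauss H.blaschke.transversal]
  simp
  module

omit [FiniteDimensional ℝ V] in
theorem IsWarpDatum.second_tv (H : IsWarpDatum γ₁ γ₂ ψ ε t u) (h₂ : γ₂ t ≠ 0) (X : V) :
    fderiv ℝ (fderiv ℝ (warp γ₁ γ₂ ψ)) (t, u) (1, 0) (0, X) =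
      fderiv ℝ (warp γ₁ γ₂ ψ) (t, u) (0, (deriv γ₂ t / γ₂ t) • X) := by
  rw [fderiv_fderiv_warp_apply H.smooth₁ H.smooth₂ H.smooth, H.fderiv_apply]
  simp [smul_smul, mul_div_cancel₀ _ h₂]

omit [FiniteDimensional ℝ V] in
theorem IsWarpDatum.second_tt (H : IsWarpDatum γ₁ γ₂ ψ ε t u) (h₁ : deriv γ₁ t ≠ 0) :
    fderiv ℝ (fderiv ℝ (warp γ₁ γ₂ ψ)) (t, u) (1, 0) (1, 0) =
      fderiv ℝ (warp γ₁ γ₂ ψ) (t, u) (deriv (deriv γ₁) t / deriv γ₁ t, 0) +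
        (wronskian γ₁ γ₂ t / deriv γ₁ t) • inc (ψ u) := by
  rw [fderiv_fderiv_warp_apply H.smooth₁ H.smooth₂ H.smooth, H.fderiv_apply]
  have e₁ : deriv γ₁ t * (deriv (deriv γ₁) t / deriv γ₁ t) = deriv (deriv γ₁) t := by
    field_simp
  have e₂ : deriv (deriv γ₂) t = deriv γ₂ t * (deriv (deriv γ₁) t / deriv γ₁ t) +
      wronskian γ₁ γ₂ t / deriv γ₁ t := by
    rw [wronskian]; field_simp; ring
  rw [e₁]
  simp
  conv_lhs => rw [e₂]
  module

/-- The affine metric of a warped surface, and the part of its connection that is determined by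
the warping. -/
structure IsWarpMetric (γ₁ γ₂ : ℝ → ℝ) (ψ : V → Fin 3 → ℝ) (ε t : ℝ) (u : V)
    (ξ : ℝ × V → Fin 4 → ℝ) : Prop where
  vv : ∀ X Y : V, metric (warp γ₁ γ₂ ψ) ξ (t, u) (0, X) (0, Y) =
    -(ε * γ₂ t * radial γ₁ γ₂ ψ ξ (t, u)) * metric ψ (fun q => -(ε • ψ q)) u X Y
  tv : ∀ X : V, metric (warp γ₁ γ₂ ψ) ξ (t, u) (1, 0) (0, X) = 0
  vt : ∀ X : V, metric (warp γ₁ γ₂ ψ) ξ (t, u) (0, X) (1, 0) = 0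
  tt : metric (warp γ₁ γ₂ ψ) ξ (t, u) (1, 0) (1, 0) =
    wronskian γ₁ γ₂ t / deriv γ₁ t * radial γ₁ γ₂ ψ ξ (t, u)
  conn_tv : ∀ X : V, inducedConnection (warp γ₁ γ₂ ψ) ξ (t, u) (1, 0) (0, X) =
    (0, (deriv γ₂ t / γ₂ t) • X)

theorem IsWarpDatum.isWarpMetric (H : IsWarpDatum γ₁ γ₂ ψ ε t u)
    (hξ : Function.Bijective (frame (warp γ₁ γ₂ ψ) ξ (t, u)))
    (h₁ : deriv γ₁ t ≠ 0) (h₂ : γ₂ t ≠ 0) : IsWarpMetric γ₁ γ₂ ψ ε t u ξ where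
  vv X Y := by
    rw [metric_apply, H.second_vv, map_add, map_smul, split_fderiv hξ]
    simp [radial]
    ring
  tv X := by rw [metric_apply, H.second_tv h₂, split_fderiv hξ]
  vt X := by
    rw [metric_symm (contDiffAt_warp H.smooth₁ H.smooth₂ H.smooth), metric_apply,
      H.second_tv h₂, split_fderiv hξ]
  tt := by
    rw [metric_apply, H.second_tt h₁, map_add, map_smul, split_fderiv hξ]
    simp [radial]
  conn_tv X := by rw [inducedConnection, H.second_tv h₂, split_fderiv hξ]

variable [Nontrivial V]

theorem IsWarpDatum.ne_zero₂ (H : IsWarpDatum γ₁ γ₂ ψ ε t u)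
    (hξ : Function.Bijective (frame (warp γ₁ γ₂ ψ) ξ (t, u))) : γ₂ t ≠ 0 := by
  intro h
  obtain ⟨X, hX⟩ := exists_ne (0 : V)
  have h0 := split_fderiv hξ (0, X)
  rw [H.fderiv_apply, h] at h0
  have : X = 0 := by simpa using h0.symm
  exact hX this

/-- If γ₁' = 0, then γ₂' ≠ 0 by immersivity, so (0, ψ) is a multiple of f_* ∂ₜ. All second
derivatives involving a surface direction would then be tangential, and h would be degenerate. -/
theorem IsWarpDatum.deriv_ne_zero₁ (H : IsWarpDatum γ₁ γ₂ ψ ε t u)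
    (hB : IsBlaschkeNormalAt (warp γ₁ γ₂ ψ) ξ (t, u)) : deriv γ₁ t ≠ 0 := by
  intro h
  have hξ := hB.transversal
  have h₂ := H.ne_zero₂ hξ
  have h₂' : deriv γ₂ t ≠ 0 := by
    intro h'
    have h0 := split_fderiv hξ (1, 0)
    rw [H.fderiv_apply, h, h'] at h0
    simp at h0
    exact zero_ne_one (congrArg (fun x : (ℝ × V) × ℝ => x.1.1) h0)
  have e : inc (ψ u) = fderiv ℝ (warp γ₁ γ₂ ψ) (t, u) ((deriv γ₂ t)⁻¹, 0) := by
    rw [H.fderiv_apply, h]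
    simp [mul_inv_cancel₀ h₂']
  obtain ⟨X, hX⟩ := exists_ne (0 : V)
  have h0 : ∀ Y, metric (warp γ₁ γ₂ ψ) ξ (t, u) (0, X) Y = 0 := by
    rintro ⟨s, Y⟩
    have e₁ : ((s, Y) : ℝ × V) = s • (1, 0) + (0, Y) := by simp
    rw [e₁, map_add, map_smul, metric_symm (contDiffAt_warp H.smooth₁ H.smooth₂ H.smooth) _ (1, 0),
      metric_apply, metric_apply, H.second_tv h₂, H.second_vv, e, map_add, map_smul,
      split_fderiv hξ, split_fderiv hξ, split_fderiv hξ]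
    simp
  have := hB.nondegenerate (0, X) h0
  exact hX (congrArg Prod.snd this)

end WarpMetric

/-! ### The volume condition in terms of the curve. -/

section Volume

variable {V : Type*} [NormedAddCommGroup V] [NormedSpace ℝ V]
  {γ₁ γ₂ : ℝ → ℝ} {ψ : V → Fin 3 → ℝ} {ε t : ℝ} {u : V} {ξ : ℝ × V → Fin 4 → ℝ}

/-- The basis `∂ₜ, e₁, e₂` of `ℝ × V`. -/
noncomputable def warpBasis (e : Module.Basis (Fin 2) ℝ V) : Module.Basis (Fin 3) ℝ (ℝ × V) :=
  ((Module.Basis.singleton (Fin 1) ℝ).prod e).reindex finSumFinEquiv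

theorem warpBasis_zero (e : Module.Basis (Fin 2) ℝ V) : warpBasis e 0 = (1, 0) := by
  have : (finSumFinEquiv (m := 1) (n := 2)).symm 0 = Sum.inl 0 := by decide
  simp [warpBasis, Module.Basis.prod_apply, this]

theorem warpBasis_one (e : Module.Basis (Fin 2) ℝ V) : warpBasis e 1 = (0, e 0) := by
  have : (finSumFinEquiv (m := 1) (n := 2)).symm 1 = Sum.inr 0 := by decide
  simp [warpBasis, Module.Basis.prod_apply, this]

theorem warpBasis_two (e : Module.Basis (Fin 2) ℝ V) : warpBasis e 2 = (0, e 1) := by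
  have : (finSumFinEquiv (m := 1) (n := 2)).symm 2 = Sum.inr 1 := by decide
  simp [warpBasis, Module.Basis.prod_apply, this]

variable [FiniteDimensional ℝ V]

/-- Cramer's rule: replacing the last row ξ by (0, ψ) multiplies the determinant by σ. Expanding the
new one along the first column, where only γ₁' survives, leaves the determinant of ψ; the factor -ε
converts ψ to its normal -εψ. -/
theorem IsWarpDatum.radial_mul_det (H : IsWarpDatum γ₁ γ₂ ψ ε t u)
    (hξ : Function.Bijective (frame (warp γ₁ γ₂ ψ) ξ (t, u))) (e : Module.Basis (Fin 2) ℝ V) :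
    radial γ₁ γ₂ ψ ξ (t, u) * (frameMatrix (warp γ₁ γ₂ ψ) ξ (warpBasis e) (t, u)).det =
      -ε * (deriv γ₁ t * γ₂ t ^ 2) * (frameMatrix ψ (fun q => -(ε • ψ q)) e u).det := by
  set A := frameMatrix (warp γ₁ γ₂ ψ) ξ (warpBasis e) (t, u) with hA
  have h₁ := Matrix.det_updateRow_sum A (Fin.last 3)
    (frameCoord (warp γ₁ γ₂ ψ) ξ (warpBasis e) (t, u) (inc (ψ u)))
  have h₂ : ∑ k, frameCoord (warp γ₁ γ₂ ψ) ξ (warpBasis e) (t, u) (inc (ψ u)) k • A k =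
      inc (ψ u) := by
    ext j
    rw [← sum_frameCoord hξ (warpBasis e) (inc (ψ u)) j]
    simp [hA]
  have h₃ : frameCoord (warp γ₁ γ₂ ψ) ξ (warpBasis e) (t, u) (inc (ψ u)) (Fin.last 3) =
      radial γ₁ γ₂ ψ ξ (t, u) :=
    Fin.snoc_last (α := fun _ => ℝ) _ _
  rw [h₂, h₃, smul_eq_mul] at h₁
  rw [← h₁]
  have hε : ε * ε = 1 := by rcases H.sign with h | h <;> rw [h] <;> norm_num
  have e₀ : A 0 = fderiv ℝ (warp γ₁ γ₂ ψ) (t, u) (1, 0) := by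
    rw [← warpBasis_zero e]; rfl
  have e₁ : A 1 = fderiv ℝ (warp γ₁ γ₂ ψ) (t, u) (0, e 0) := by
    rw [← warpBasis_one e]; rfl
  have e₂ : A 2 = fderiv ℝ (warp γ₁ γ₂ ψ) (t, u) (0, e 1) := by
    rw [← warpBasis_two e]; rfl
  rw [H.fderiv_apply] at e₀ e₁ e₂
  have hrow : A.updateRow (Fin.last 3) (inc (ψ u)) =
      Matrix.of ![A 0, A 1, A 2, inc (ψ u)] := by
    ext i j
    fin_cases i <;> simp [Matrix.updateRow_apply, Fin.ext_iff]
  have hrow' : frameMatrix ψ (fun q => -(ε • ψ q)) e u =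
      Matrix.of ![fderiv ℝ ψ u (e 0), fderiv ℝ ψ u (e 1), -(ε • ψ u)] := by
    ext i j
    fin_cases i <;> rfl
  have i₁ : ∀ v : Fin 3 → ℝ, inc v 1 = v 0 := fun v => rfl
  have i₂ : ∀ v : Fin 3 → ℝ, inc v 2 = v 1 := fun v => rfl
  have i₃ : ∀ v : Fin 3 → ℝ, inc v 3 = v 2 := fun v => rfl
  rw [hrow, hrow', e₀, e₁, e₂, Matrix.det_succ_column_zero, Fin.sum_univ_four]
  simp [Matrix.det_fin_three, Matrix.submatrix, Fin.succAbove, north_zero, inc_zero, i₁, i₂, i₃,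
    show north 1 = 0 from rfl, show north 2 = 0 from rfl, show north 3 = 0 from rfl]
  linear_combination (-deriv γ₁ t * γ₂ t ^ 2 * (
    fderiv ℝ ψ u (e 0) 0 * fderiv ℝ ψ u (e 1) 1 * ψ u 2 -
    fderiv ℝ ψ u (e 0) 0 * fderiv ℝ ψ u (e 1) 2 * ψ u 1 -
    fderiv ℝ ψ u (e 0) 1 * fderiv ℝ ψ u (e 1) 0 * ψ u 2 +
    fderiv ℝ ψ u (e 0) 1 * fderiv ℝ ψ u (e 1) 2 * ψ u 0 +
    fderiv ℝ ψ u (e 0) 2 * fderiv ℝ ψ u (e 1) 0 * ψ u 1 -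
    fderiv ℝ ψ u (e 0) 2 * fderiv ℝ ψ u (e 1) 1 * ψ u 0)) * hε

/-- The volume condition of a warped surface. -/
theorem IsWarpDatum.volume_iff (H : IsWarpDatum γ₁ γ₂ ψ ε t u)
    (hξ : Function.Bijective (frame (warp γ₁ γ₂ ψ) ξ (t, u))) (e : Module.Basis (Fin 2) ℝ V)
    (h₁ : deriv γ₁ t ≠ 0) (h₂ : γ₂ t ≠ 0) :
    (|(frameMatrix (warp γ₁ γ₂ ψ) ξ (warpBasis e) (t, u)).det| = Real.sqrt |Matrix.det
      (Matrix.of fun i j => metric (warp γ₁ γ₂ ψ) ξ (t, u) (warpBasis e i) (warpBasis e j))|) ↔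
      |deriv γ₁ t| ^ 3 * γ₂ t ^ 2 =
        |radial γ₁ γ₂ ψ ξ (t, u)| ^ 5 * |wronskian γ₁ γ₂ t| := by
  have hM := H.isWarpMetric hξ h₁ h₂
  have hdet := H.radial_mul_det hξ e
  have hvol := H.blaschke.volume_eq e
  have hd0 : (frameMatrix ψ (fun q => -(ε • ψ q)) e u).det ≠ 0 :=
    det_frameMatrix_ne_zero H.blaschke.transversal e
  have hε : |ε| = 1 := by rcases H.sign with h | h <;> rw [h] <;> norm_num
  change |(frameMatrix ψ (fun q => -(ε • ψ q)) e u).det| = _ at hvol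
  set g := Matrix.det (Matrix.of fun i j => metric ψ (fun q => -(ε • ψ q)) u (e i) (e j)) with hg
  set σ := radial γ₁ γ₂ ψ ξ (t, u) with hσ
  set W := wronskian γ₁ γ₂ t
  have hG : Matrix.det (Matrix.of fun i j =>
      metric (warp γ₁ γ₂ ψ) ξ (t, u) (warpBasis e i) (warpBasis e j)) =
      W / deriv γ₁ t * σ * (ε * γ₂ t * σ) ^ 2 * g := by
    rw [hg, Matrix.det_fin_three, Matrix.det_fin_two]
    simp only [Matrix.of_apply, warpBasis_zero, warpBasis_one, warpBasis_two, hM.vv, hM.tv, hM.vt,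
      hM.tt]
    ring
  rw [hG]
  set d := (frameMatrix (warp γ₁ γ₂ ψ) ξ (warpBasis e) (t, u)).det
  set d' := (frameMatrix ψ (fun q => -(ε • ψ q)) e u).det
  have hd' : d' ^ 2 = |g| := by
    rw [← sq_abs, hvol, Real.sq_sqrt (abs_nonneg _)]
  have hg0 : 0 < |g| := by rw [← hd']; positivity
  have hσ0 : σ ≠ 0 := by
    intro h0
    rw [h0, zero_mul] at hdet
    have hε0 : ε ≠ 0 := fun h => by simp [h] at hε
    exact (mul_ne_zero (mul_ne_zero (neg_ne_zero.2 hε0) (mul_ne_zero h₁ (pow_ne_zero 2 h₂))) hd0)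
      hdet.symm
  have hdet' : σ ^ 2 * d ^ 2 = |deriv γ₁ t| ^ 2 * γ₂ t ^ 4 * |g| := by
    rw [← hd', ← mul_pow, hdet, sq_abs]
    have : ε ^ 2 = 1 := by rw [← sq_abs, hε, one_pow]
    linear_combination (deriv γ₁ t * γ₂ t ^ 2 * d') ^ 2 * this
  have habs : |W / deriv γ₁ t * σ * (ε * γ₂ t * σ) ^ 2 * g| =
      |W| / |deriv γ₁ t| * |σ| ^ 3 * γ₂ t ^ 2 * |g| := by
    simp only [abs_mul, abs_div, abs_pow, hε, mul_pow, sq_abs]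
    rw [← sq_abs σ]
    ring
  rw [habs, eq_comm, Real.sqrt_eq_iff_mul_self_eq (by positivity) (abs_nonneg _), abs_mul_abs_self]
  have hγ : 0 < |deriv γ₁ t| := abs_pos.2 h₁
  have hσ' : 0 < |σ| := abs_pos.2 hσ0
  have hσ2 : σ ^ 2 = |σ| ^ 2 := (sq_abs σ).symm
  rw [hσ2] at hdet'
  have hγ2 : 0 < γ₂ t ^ 2 := by positivity
  -- Multiplying the squared condition by |σ|²|γ₁'| lets `hdet'` eliminate d. Then |g| splits off as
  -- a factor, and with it all dependence on the surface metric.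
  have key : |σ| ^ 2 * |deriv γ₁ t| *
      (d * d - |W| / |deriv γ₁ t| * |σ| ^ 3 * γ₂ t ^ 2 * |g|) =
      γ₂ t ^ 2 * |g| * (|deriv γ₁ t| ^ 3 * γ₂ t ^ 2 - |σ| ^ 5 * |W|) := by
    field_simp
    linear_combination |deriv γ₁ t| * hdet'
  constructor
  · intro h
    have h0 : γ₂ t ^ 2 * |g| * (|deriv γ₁ t| ^ 3 * γ₂ t ^ 2 - |σ| ^ 5 * |W|) = 0 := by
      rw [← key, h]; ring
    have := (mul_eq_zero.1 h0).resolve_left (by positivity)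
    linarith
  · intro h
    have h0 : |σ| ^ 2 * |deriv γ₁ t| *
        (d * d - |W| / |deriv γ₁ t| * |σ| ^ 3 * γ₂ t ^ 2 * |g|) = 0 := by
      rw [key, h]; ring
    have := (mul_eq_zero.1 h0).resolve_left (by positivity)
    linarith

end Volume

/-! ### The cubic form in the directions determined by the warping. -/

section Cubic

variable {V : Type*} [NormedAddCommGroup V] [NormedSpace ℝ V] [FiniteDimensional ℝ V]
  {γ₁ γ₂ : ℝ → ℝ} {ψ : V → Fin 3 → ℝ} {ε t : ℝ} {u : V} {ξ : ℝ × V → Fin 4 → ℝ}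

omit [FiniteDimensional ℝ V] in
theorem IsWarpMetric.tt_ne_zero (hM : IsWarpMetric γ₁ γ₂ ψ ε t u ξ)
    (hB : IsBlaschkeNormalAt (warp γ₁ γ₂ ψ) ξ (t, u)) :
    metric (warp γ₁ γ₂ ψ) ξ (t, u) (1, 0) (1, 0) ≠ 0 := by
  intro h
  have := hB.nondegenerate (1, 0) fun ⟨s, Y⟩ => by
    have e₁ : ((s, Y) : ℝ × V) = s • (1, 0) + (0, Y) := by simp
    rw [e₁, map_add, map_smul, h, hM.tv]
    simp
  exact one_ne_zero (congrArg Prod.fst this)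

omit [FiniteDimensional ℝ V] in
theorem IsWarpMetric.ne_zero (hM : IsWarpMetric γ₁ γ₂ ψ ε t u ξ)
    (hB : IsBlaschkeNormalAt (warp γ₁ γ₂ ψ) ξ (t, u)) :
    wronskian γ₁ γ₂ t ≠ 0 ∧ radial γ₁ γ₂ ψ ξ (t, u) ≠ 0 := by
  have h := hM.tt_ne_zero hB
  rw [hM.tt] at h
  exact ⟨fun h0 => h (by simp [h0]), fun h0 => h (by simp [h0])⟩

theorem differentiableAt_radial (H : IsWarpDatum γ₁ γ₂ ψ ε t u)
    (hB : IsBlaschkeNear (warp γ₁ γ₂ ψ) ξ (t, u)) :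
    DifferentiableAt ℝ (radial γ₁ γ₂ ψ ξ) (t, u) := by
  obtain ⟨hf, hξ, hB⟩ := hB.self_of_nhds
  have hψ : DifferentiableAt ℝ (fun z : ℝ × V => inc (ψ z.2)) (t, u) :=
    inc.differentiableAt.comp (t, u)
      ((H.smooth.differentiableAt (by simp)).comp (t, u) differentiableAt_snd)
  exact (((contDiffAt_split hf hξ hB.transversal).differentiableAt (by simp)).clm_apply hψ).snd

variable [Nontrivial V]

theorem IsWarpDatum.isWarpMetric_of_blaschke (H : IsWarpDatum γ₁ γ₂ ψ ε t u)
    (hB : IsBlaschkeNormalAt (warp γ₁ γ₂ ψ) ξ (t, u)) : IsWarpMetric γ₁ γ₂ ψ ε t u ξ :=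
  H.isWarpMetric hB.transversal (H.deriv_ne_zero₁ hB) (H.ne_zero₂ hB.transversal)

theorem tendsto_line {E : Type*} [NormedAddCommGroup E] [NormedSpace ℝ E] (y X : E) :
    Tendsto (fun s : ℝ => y + s • X) (𝓝 0) (𝓝 y) := by
  have : Continuous fun s : ℝ => y + s • X := by fun_prop
  simpa using this.tendsto 0

/-- The volume condition fixes |σ| as a function of t alone. Squaring it to σ¹⁰W² removes the
absolute values before differentiating along the surface. -/
theorem fderiv_radial_eq_zero (H : ∀ᶠ z in 𝓝 (t, u), IsWarpDatum γ₁ γ₂ ψ ε z.1 z.2)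
    (hB : IsBlaschkeNear (warp γ₁ γ₂ ψ) ξ (t, u)) (e : Module.Basis (Fin 2) ℝ V) (X : V) :
    fderiv ℝ (radial γ₁ γ₂ ψ ξ) (t, u) (0, X) = 0 := by
  have hσ := differentiableAt_radial H.self_of_nhds hB
  have hM := H.self_of_nhds.isWarpMetric_of_blaschke hB.self_of_nhds.2.2
  obtain ⟨hW, hσ0⟩ := hM.ne_zero hB.self_of_nhds.2.2
  have hl := ((hasDerivAt_line hσ (0, X)).pow 10).mul_const (wronskian γ₁ γ₂ t ^ 2)
  have hc : (fun s : ℝ => radial γ₁ γ₂ ψ ξ ((t, u) + s • (0, X)) ^ 10 * wronskian γ₁ γ₂ t ^ 2)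
      =ᶠ[𝓝 0] fun _ => (|deriv γ₁ t| ^ 3 * γ₂ t ^ 2) ^ 2 := by
    filter_upwards [(tendsto_line (t, u) ((0 : ℝ), X)).eventually (H.and hB)] with s hs
    have e₁ : (t, u) + s • ((0 : ℝ), X) = (t, u + s • X) := by simp
    rw [e₁] at hs ⊢
    obtain ⟨hs₁, -, -, hs₂⟩ := hs
    have hv := (hs₁.volume_iff hs₂.transversal e (hs₁.deriv_ne_zero₁ hs₂)
      (hs₁.ne_zero₂ hs₂.transversal)).1 (hs₂.volume_eq _)
    simp only at hv
    rw [hv, mul_pow, ← pow_mul, sq_abs, (by decide : Even (5 * 2)).pow_abs]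
  have := hl.unique ((hasDerivAt_const (0 : ℝ) _).congr_of_eventuallyEq hc)
  simpa [hW, hσ0] using this

/-- `(∇_X h)(∂ₜ, ∂ₜ) = 0` for vectors `X` that are tangent to the surface. -/
theorem metric_differenceTensor_vtt (H : ∀ᶠ z in 𝓝 (t, u), IsWarpDatum γ₁ γ₂ ψ ε z.1 z.2)
    (hB : IsBlaschkeNear (warp γ₁ γ₂ ψ) ξ (t, u)) (e : Module.Basis (Fin 2) ℝ V) (X : V) :
    metric (warp γ₁ γ₂ ψ) ξ (t, u)
      (differenceTensor (warp γ₁ γ₂ ψ) ξ (t, u) (0, X) (1, 0)) (1, 0) = 0 := by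
  have hM := H.self_of_nhds.isWarpMetric_of_blaschke hB.self_of_nhds.2.2
  have hf := hB.self_of_nhds.1
  have hσ := differentiableAt_radial H.self_of_nhds hB
  have h₁ := hasDerivAt_line (hB.differentiableAt_metric_apply (1, 0) (1, 0)) (0, X)
  -- Along the surface, h(∂ₜ, ∂ₜ) varies only through σ, which is stationary there.
  have hc : (fun s : ℝ => metric (warp γ₁ γ₂ ψ) ξ ((t, u) + s • (0, X)) (1, 0) (1, 0)) =ᶠ[𝓝 0]
      fun s : ℝ => wronskian γ₁ γ₂ t / deriv γ₁ t *
        radial γ₁ γ₂ ψ ξ ((t, u) + s • (0, X)) := by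
    filter_upwards [(tendsto_line (t, u) ((0 : ℝ), X)).eventually (H.and hB)] with s hs
    have e₁ : (t, u) + s • ((0 : ℝ), X) = (t, u + s • X) := by simp
    rw [e₁] at hs ⊢
    exact (hs.1.isWarpMetric_of_blaschke hs.2.2.2).tt
  have h₂ := h₁.unique
    (((hasDerivAt_line hσ (0, X)).const_mul _).congr_of_eventuallyEq hc)
  rw [fderiv_radial_eq_zero H hB e X, mul_zero, fderiv_metric_apply hB] at h₂
  rw [metric_differenceTensor hB, h₂, inducedConnection_symm hf, hM.conn_tv, hM.vt, hM.tv]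
  simp

/-- `∇_∂ₜ h` is a multiple of the metric of the surface. -/
theorem exists_metric_differenceTensor_tvv
    (H : ∀ᶠ z in 𝓝 (t, u), IsWarpDatum γ₁ γ₂ ψ ε z.1 z.2)
    (hB : IsBlaschkeNear (warp γ₁ γ₂ ψ) ξ (t, u)) :
    ∃ k : ℝ, ∀ X Y : V, metric (warp γ₁ γ₂ ψ) ξ (t, u)
      (differenceTensor (warp γ₁ γ₂ ψ) ξ (t, u) (1, 0) (0, X)) (0, Y) =
        k * metric ψ (fun q => -(ε • ψ q)) u X Y := by
  have hM := H.self_of_nhds.isWarpMetric_of_blaschke hB.self_of_nhds.2.2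
  have hf := hB.self_of_nhds.1
  have hσ := hasDerivAt_line (differentiableAt_radial H.self_of_nhds hB) (1, 0)
  have hγ : DifferentiableAt ℝ (fun s : ℝ => γ₂ (t + s)) 0 := by
    have : DifferentiableAt ℝ γ₂ (t + 0) := by
      simpa using H.self_of_nhds.smooth₂.differentiableAt (by simp)
    exact this.comp (0 : ℝ) (by fun_prop)
  -- The conformal factor between h on surface directions and the surface metric, followed along the
  -- t-line. The connection acts on each of the two surface arguments as γ₂'/γ₂, hence the 2 in the
  -- witness.
  let A : ℝ → ℝ := fun s => -(ε * γ₂ (t + s) * radial γ₁ γ₂ ψ ξ ((t, u) + s • (1, 0)))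
  have hA : DifferentiableAt ℝ A 0 := ((hγ.const_mul ε).mul hσ.differentiableAt).neg
  refine ⟨-(1 / 2) * (deriv A 0 - 2 * (deriv γ₂ t / γ₂ t) *
    -(ε * γ₂ t * radial γ₁ γ₂ ψ ξ (t, u))), fun X Y => ?_⟩
  have h₁ := hasDerivAt_line (hB.differentiableAt_metric_apply (0, X) (0, Y)) (1, 0)
  have hc : (fun s : ℝ => metric (warp γ₁ γ₂ ψ) ξ ((t, u) + s • (1, 0)) (0, X) (0, Y)) =ᶠ[𝓝 0]
      fun s : ℝ => A s * metric ψ (fun q => -(ε • ψ q)) u X Y := by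
    filter_upwards [(tendsto_line (t, u) ((1 : ℝ), (0 : V))).eventually (H.and hB)] with s hs
    have e₁ : (t, u) + s • ((1 : ℝ), (0 : V)) = (t + s, u) := by simp
    simp only [A]
    rw [e₁] at hs ⊢
    exact (hs.1.isWarpMetric_of_blaschke hs.2.2.2).vv X Y
  have h₂ := h₁.unique ((hA.hasDerivAt.mul_const _).congr_of_eventuallyEq hc)
  rw [fderiv_metric_apply hB] at h₂
  rw [metric_differenceTensor hB, h₂, hM.conn_tv, hM.conn_tv, hM.vv, hM.vv]
  simp
  ring

end Cubic

/-! ### Adapted orthonormal bases. -/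

section SpecialBasis

variable {V : Type*} [NormedAddCommGroup V] [NormedSpace ℝ V] [FiniteDimensional ℝ V]

theorem exists_orthonormal_basis (hV : Module.finrank ℝ V = 2) (g : V →L[ℝ] V →L[ℝ] ℝ)
    (hs : ∀ X Y, g X Y = g Y X) (hp : ∀ X, X ≠ 0 → 0 < g X X) :
    ∃ e : Module.Basis (Fin 2) ℝ V, g (e 0) (e 0) = 1 ∧ g (e 1) (e 1) = 1 ∧
      g (e 0) (e 1) = 0 ∧ g (e 1) (e 0) = 0 := by
  let B : LinearMap.BilinForm ℝ V :=
    LinearMap.mk₂ ℝ (fun X Y => g X Y) (by simp) (by simp) (by simp) (by simp)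
  obtain ⟨v, hv⟩ := LinearMap.BilinForm.exists_orthogonal_basis (B := B) ⟨fun X Y => hs X Y⟩
  let v' := v.reindex (finCongr hV)
  have hpos : ∀ i, 0 < g (v' i) (v' i) := fun i => hp _ (v'.ne_zero i)
  have hne : ∀ i, IsUnit (Real.sqrt (g (v' i) (v' i)))⁻¹ := fun i =>
    isUnit_iff_ne_zero.2 (inv_ne_zero (Real.sqrt_pos.2 (hpos i)).ne')
  have horth : ∀ i j, i ≠ j → g (v' i) (v' j) = 0 := fun i j hij => by
    have := hv (i := (finCongr hV).symm i) (j := (finCongr hV).symm j) (by simpa using hij)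
    simpa [v', B] using this
  have hnorm : ∀ i, (Real.sqrt (g (v' i) (v' i)))⁻¹ *
      ((Real.sqrt (g (v' i) (v' i)))⁻¹ * g (v' i) (v' i)) = 1 := fun i => by
    have := Real.mul_self_sqrt (hpos i).le
    have h0 := (Real.sqrt_pos.2 (hpos i)).ne'
    field_simp
    linarith [sq (Real.sqrt (g (v' i) (v' i)))]
  refine ⟨v'.isUnitSMul hne, ?_, ?_, ?_, ?_⟩
  · simpa [Module.Basis.isUnitSMul_apply] using hnorm 0
  · simpa [Module.Basis.isUnitSMul_apply] using hnorm 1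
  · simp [Module.Basis.isUnitSMul_apply, horth 0 1 (by decide)]
  · simp [Module.Basis.isUnitSMul_apply, horth 1 0 (by decide)]

omit [FiniteDimensional ℝ V] in
/-- A Lorentz metric on `ℝ × V` that is the orthogonal sum of a multiple of `dt²` and a multiple
of a definite form is negative on `ℝ` and positive on `V`. -/
theorem signs_of_lorentz {h : ℝ × V →L[ℝ] ℝ × V →L[ℝ] ℝ} {b : Module.Basis (Fin 3) ℝ (ℝ × V)}
    (hb : IsLorentzONB h b) {g : V →L[ℝ] V →L[ℝ] ℝ} {e : Module.Basis (Fin 2) ℝ V} {a r : ℝ}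
    (g00 : g (e 0) (e 0) = 1) (g11 : g (e 1) (e 1) = 1) (g01 : g (e 0) (e 1) = 0)
    (g10 : g (e 1) (e 0) = 0) (hvv : ∀ X Y, h (0, X) (0, Y) = r * g X Y)
    (htv : ∀ X, h (1, 0) (0, X) = 0) (hvt : ∀ X, h (0, X) (1, 0) = 0)
    (htt : h (1, 0) (1, 0) = a) (ha : a ≠ 0) (hr : r ≠ 0) : a < 0 ∧ 0 < r := by
  have hr' : 0 < r := by
    by_contra hlt
    -- Otherwise h is negative definite on the plane V, which meets the hyperplane spanned by `b 1`
    -- and `b 2`, where h ≥ 0. The vector q e₀ - p e₁ below lies in both.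
    have hneg : r < 0 := lt_of_le_of_ne (not_lt.1 hlt) hr
    have hq : ∀ x y : ℝ, h (0, x • e 0 + y • e 1) (0, x • e 0 + y • e 1) =
        r * (x ^ 2 + y ^ 2) := fun x y => by
      rw [hvv]
      simp only [map_add, map_smul, add_apply, smul_apply, smul_eq_mul, g00, g11, g01, g10]
      ring
    have hpos : ∀ X, b.repr X 0 = 0 → 0 ≤ h X X := fun X hX => by
      rw [hb.apply_apply, hX]
      nlinarith [sq_nonneg (b.repr X 1), sq_nonneg (b.repr X 2)]
    by_cases h0 : b.repr (0, e 0) 0 = 0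
    · have := hpos _ h0
      rw [hvv, g00] at this
      linarith
    · set p := b.repr (0, e 0) 0
      set q := b.repr (0, e 1) 0
      have h1 : b.repr (0, q • e 0 + (-p) • e 1) 0 = 0 := by
        have : ((0, q • e 0 + (-p) • e 1) : ℝ × V) = q • (0, e 0) + (-p) • (0, e 1) := by simp
        rw [this]
        simp only [map_add, map_smul, Finsupp.add_apply, Finsupp.smul_apply, smul_eq_mul]
        ring
      have := hpos _ h1
      rw [hq] at this
      have hp2 : 0 < p ^ 2 := by positivity
      nlinarith [sq_nonneg q]
  refine ⟨?_, hr'⟩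
  by_contra hlt
  -- Now h would be positive definite, against h(b₀, b₀) = -1.
  have hpos : 0 < a := lt_of_le_of_ne (not_lt.1 hlt) (Ne.symm ha)
  have h00 : h (b 0) (b 0) = -1 := by simpa using hb 0 0
  have hx : b 0 = (b 0).1 • (1, 0) + (0, e.repr (b 0).2 0 • e 0 + e.repr (b 0).2 1 • e 1) := by
    have := e.sum_repr (b 0).2
    rw [Fin.sum_univ_two] at this
    rw [this]
    simp
  rw [hx] at h00
  simp only [map_add, map_smul, add_apply, smul_apply, hvv, htv, hvt, htt, smul_eq_mul,
    g00, g11, g01, g10] at h00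
  have := mul_pos hr' hr'
  nlinarith [mul_nonneg hpos.le (sq_nonneg (b 0).1), mul_nonneg hr'.le (sq_nonneg (e.repr (b 0).2 0)),
    mul_nonneg hr'.le (sq_nonneg (e.repr (b 0).2 1))]

omit [FiniteDimensional ℝ V] in
/-- The Lorentz orthonormal basis that is adapted to the decomposition `ℝ × V`. -/
theorem exists_isLorentzONB {h : ℝ × V →L[ℝ] ℝ × V →L[ℝ] ℝ} {g : V →L[ℝ] V →L[ℝ] ℝ}
    {e : Module.Basis (Fin 2) ℝ V} {a r : ℝ} (g00 : g (e 0) (e 0) = 1) (g11 : g (e 1) (e 1) = 1)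
    (g01 : g (e 0) (e 1) = 0) (g10 : g (e 1) (e 0) = 0)
    (hvv : ∀ X Y, h (0, X) (0, Y) = r * g X Y)
    (htv : ∀ X, h (1, 0) (0, X) = 0) (hvt : ∀ X, h (0, X) (1, 0) = 0)
    (htt : h (1, 0) (1, 0) = a) (ha : a < 0) (hr : 0 < r) :
    ∃ (b : Module.Basis (Fin 3) ℝ (ℝ × V)) (x y : ℝ), IsLorentzONB h b ∧ b 0 = x • (1, 0) ∧
      b 1 = y • (0, e 0) ∧ b 2 = y • (0, e 1) := by
  have ha' : 0 < Real.sqrt (-a) := Real.sqrt_pos.2 (by linarith)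
  have hr' : 0 < Real.sqrt r := Real.sqrt_pos.2 hr
  have ea : Real.sqrt (-a) ^ 2 = -a := Real.sq_sqrt (by linarith)
  have er : Real.sqrt r ^ 2 = r := Real.sq_sqrt hr.le
  have hw : ∀ i : Fin 3, IsUnit (![(Real.sqrt (-a))⁻¹, (Real.sqrt r)⁻¹, (Real.sqrt r)⁻¹] i) := by
    intro i
    fin_cases i
    · exact isUnit_iff_ne_zero.2 (inv_ne_zero ha'.ne')
    · exact isUnit_iff_ne_zero.2 (inv_ne_zero hr'.ne')
    · exact isUnit_iff_ne_zero.2 (inv_ne_zero hr'.ne')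
  have b0 : (warpBasis e).isUnitSMul hw 0 = (Real.sqrt (-a))⁻¹ • (1, 0) := by
    rw [Module.Basis.isUnitSMul_apply, warpBasis_zero]; rfl
  have b1 : (warpBasis e).isUnitSMul hw 1 = (Real.sqrt r)⁻¹ • (0, e 0) := by
    rw [Module.Basis.isUnitSMul_apply, warpBasis_one]; rfl
  have b2 : (warpBasis e).isUnitSMul hw 2 = (Real.sqrt r)⁻¹ • (0, e 1) := by
    rw [Module.Basis.isUnitSMul_apply, warpBasis_two]; rfl
  refine ⟨(warpBasis e).isUnitSMul hw, _, _, ?_, b0, b1, b2⟩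
  have k₀ : (Real.sqrt (-a))⁻¹ * ((Real.sqrt (-a))⁻¹ * a) = -1 := by
    field_simp
    linarith
  have k₁ : (Real.sqrt r)⁻¹ * ((Real.sqrt r)⁻¹ * r) = 1 := by
    field_simp
    linarith
  intro i j
  fin_cases i <;> fin_cases j <;>
    simp only [Fin.zero_eta, Fin.mk_one, Fin.reduceFinMk, b0, b1, b2, map_smul, smul_apply, hvv,
      htv, hvt, htt, g00, g11, g01, g10, smul_eq_mul, mul_one, mul_zero, k₀, k₁] <;>
    simp [Matrix.diagonal]

end SpecialBasis

/-! ### The two directions of the theorem in coordinates. -/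

section Local

variable {V : Type*} [NormedAddCommGroup V] [NormedSpace ℝ V] [FiniteDimensional ℝ V]
  {γ₁ γ₂ : ℝ → ℝ} {ψ : V → Fin 3 → ℝ} {ε t : ℝ} {u : V} {ξ : ℝ × V → Fin 4 → ℝ}

/-- The difference tensor of a warped indefinite hypersurface has the normal form in a suitable
Lorentz orthonormal basis. -/
theorem exists_isNormalForm (hV : Module.finrank ℝ V = 2)
    (H : ∀ᶠ z in 𝓝 (t, u), IsWarpDatum γ₁ γ₂ ψ ε z.1 z.2)
    (hB : IsBlaschkeNear (warp γ₁ γ₂ ψ) ξ (t, u))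
    (hp : ∀ X, X ≠ 0 → 0 < metric ψ (fun q => -(ε • ψ q)) u X X)
    (hL : ∃ b : Module.Basis (Fin 3) ℝ (ℝ × V),
      IsLorentzONB (metric (warp γ₁ γ₂ ψ) ξ (t, u)) b) :
    ∃ (b : Module.Basis (Fin 3) ℝ (ℝ × V)) (l r q : ℝ),
      IsLorentzONB (metric (warp γ₁ γ₂ ψ) ξ (t, u)) b ∧
      IsNormalForm (differenceBilin (warp γ₁ γ₂ ψ) ξ (t, u)) b l r q := by
  have : Nontrivial V := Module.nontrivial_of_finrank_pos (R := ℝ) (by omega)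
  have H₀ := H.self_of_nhds
  have hB₀ := hB.self_of_nhds.2.2
  have hM := H₀.isWarpMetric_of_blaschke hB₀
  obtain ⟨e, g00, g11, g01, g10⟩ := exists_orthonormal_basis hV
    (metric ψ (fun q => -(ε • ψ q)) u) (metric_symm H₀.smooth) hp
  obtain ⟨b', hb'⟩ := hL
  have hr : -(ε * γ₂ t * radial γ₁ γ₂ ψ ξ (t, u)) ≠ 0 := by
    have hε : ε ≠ 0 := by rcases H₀.sign with h | h <;> rw [h] <;> norm_num
    exact neg_ne_zero.2 (mul_ne_zero (mul_ne_zero hε (H₀.ne_zero₂ hB₀.transversal))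
      (hM.ne_zero hB₀).2)
  obtain ⟨ha, hr⟩ := signs_of_lorentz hb' g00 g11 g01 g10 hM.vv hM.tv hM.vt rfl
    (hM.tt_ne_zero hB₀) hr
  obtain ⟨b, x, y, hb, b0, b1, b2⟩ := exists_isLorentzONB g00 g11 g01 g10 hM.vv hM.tv hM.vt rfl
    ha hr
  set h := metric (warp γ₁ γ₂ ψ) ξ (t, u)
  set K := differenceBilin (warp γ₁ γ₂ ψ) ξ (t, u) with hK
  have hs : ∀ X Y Z, h (K X Y) Z = h (K Y X) Z := metric_differenceTensor_symm hB
  have hs' : ∀ X Y Z, h (K X Y) Z = h (K X Z) Y := metric_differenceTensor_symm_right hB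
  have hvtt : ∀ X, h (K (0, X) (1, 0)) (1, 0) = 0 := metric_differenceTensor_vtt H hB e
  obtain ⟨k, hk⟩ := exists_metric_differenceTensor_tvv H hB
  have hk' : ∀ X Y : V, h (K (1, 0) (0, X)) (0, Y) =
    k * metric ψ (fun q => -(ε • ψ q)) u X Y := hk
  -- The trace of K written with h; the minus sign is h(t, t) = -1.
  have hap : ∀ i, -h (K (b i) (b 0)) (b 0) + h (K (b i) (b 1)) (b 1) +
      h (K (b i) (b 2)) (b 2) = 0 := fun i => by
    have := apolarity hB b (b i)
    rw [Fin.sum_univ_three] at this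
    rw [(hb.apply_basis _).1, (hb.apply_basis _).2.1, (hb.apply_basis _).2.2, neg_neg]
    exact this
  have z1 : h (K (b 1) (b 0)) (b 0) = 0 := by
    rw [b0, b1]; simp only [map_smul, LinearMap.smul_apply, smul_apply, hvtt, smul_zero]
  have z2 : h (K (b 2) (b 0)) (b 0) = 0 := by
    rw [b0, b2]; simp only [map_smul, LinearMap.smul_apply, smul_apply, hvtt, smul_zero]
  refine ⟨b, _, _, _, hb, hb.isNormalForm hs hs' ?_ ?_ ?_ ?_ (hap 0) ?_ ?_⟩
  · rw [hs', hs, z1]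
  · rw [hs', hs, z2]
  · rw [b0, b1, b2]
    simp only [map_smul, LinearMap.smul_apply, smul_apply, hk', g01, smul_zero, mul_zero]
  · rw [b0, b1, b2]
    simp only [map_smul, LinearMap.smul_apply, smul_apply, hk', g00, g11]
  · simpa [z1] using hap 1
  · simpa [z2] using hap 2

/-- A transversal vector field `ξ = (a, b ψ)` with `D ξ = -c D f` is the affine normal if it
satisfies the volume condition. -/
theorem IsWarpDatum.isBlaschkeNormalAt (hV : Module.finrank ℝ V = 2)
    (H : IsWarpDatum γ₁ γ₂ ψ ε t u) {a b c : ℝ}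
    (hξ : ξ (t, u) = a • north + b • inc (ψ u))
    (hξ' : ∀ X, fderiv ℝ ξ (t, u) X = (-c) • fderiv ℝ (warp γ₁ γ₂ ψ) (t, u) X)
    (h₁ : deriv γ₁ t ≠ 0) (h₂ : γ₂ t ≠ 0) (hW : wronskian γ₁ γ₂ t ≠ 0)
    (hD : deriv γ₁ t * b - deriv γ₂ t * a ≠ 0)
    (hvol : γ₂ t ^ 2 * |deriv γ₁ t * b - deriv γ₂ t * a| ^ 5 =
      |wronskian γ₁ γ₂ t| * deriv γ₁ t ^ 2) :
    IsBlaschkeNormalAt (warp γ₁ γ₂ ψ) ξ (t, u) ∧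
      (∀ X, shape (warp γ₁ γ₂ ψ) ξ (t, u) X = c • X) ∧
      IsWarpMetric γ₁ γ₂ ψ ε t u ξ ∧
      radial γ₁ γ₂ ψ ξ (t, u) = deriv γ₁ t / (deriv γ₁ t * b - deriv γ₂ t * a) := by
  set D := deriv γ₁ t * b - deriv γ₂ t * a with hDdef
  have hε : ε * ε = 1 := by rcases H.sign with h | h <;> rw [h] <;> norm_num
  have hbij : Function.Bijective (frame (warp γ₁ γ₂ ψ) ξ (t, u)) := by
    have hinj : Function.Injective (frame (warp γ₁ γ₂ ψ) ξ (t, u)) := by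
      refine (injective_iff_map_eq_zero _).2 ?_
      rintro ⟨⟨s, X⟩, r⟩ h0
      rw [frame_apply, H.fderiv_apply, hξ] at h0
      have h0' : (deriv γ₁ t * s + r * a) • north +
          inc ((deriv γ₂ t * s + r * b) • ψ u + γ₂ t • fderiv ℝ ψ u X) =
            (0 : ℝ) • north + inc 0 := by
        rw [map_zero, zero_smul, zero_add, ← h0]
        simp only [map_add, map_smul]
        module
      obtain ⟨k₁, k₂⟩ := smul_north_add_inc_inj h0'
      have k₃ : frame ψ (fun q => -(ε • ψ q)) u (γ₂ t • X, -ε * (deriv γ₂ t * s + r * b)) =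
          0 := by
        rw [frame_apply, ← k₂]
        simp only [map_smul]
        linear_combination (norm := module) ((deriv γ₂ t * s + r * b) • hε) • ψ u
      have k₄ := H.blaschke.transversal.1 (k₃.trans (map_zero _).symm)
      have hε0 : ε ≠ 0 := fun h => by simp [h] at hε
      have kX : X = 0 := (smul_eq_zero.1 (congrArg Prod.fst k₄)).resolve_left h₂
      have k₅ : deriv γ₂ t * s + r * b = 0 :=
        (mul_eq_zero.1 (congrArg Prod.snd k₄)).resolve_left (neg_ne_zero.2 hε0)
      -- D is the determinant of γ' and (a, b), so D ≠ 0 is transversality of ξ to the curve in the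
      -- (∂₀, ψ)-plane.
      have kr : r * D = 0 := by
        rw [hDdef]; linear_combination deriv γ₁ t * k₅ - deriv γ₂ t * k₁
      have kr' := (mul_eq_zero.1 kr).resolve_right hD
      have ks : s = 0 := by
        rw [kr', zero_mul, add_zero] at k₁
        exact (mul_eq_zero.1 k₁).resolve_left h₁
      rw [kX, kr', ks]
      rfl
    refine ⟨hinj, (LinearMap.injective_iff_surjective_of_finrank_eq_finrank
      (f := (frame (warp γ₁ γ₂ ψ) ξ (t, u)).toLinearMap) ?_).1 hinj⟩
    simp [hV]
  -- Solve (0, ψ) = x f_* ∂ₜ + y ξ in the plane of ∂₀ and (0, ψ): x = -a/D and y = γ₁'/D, so σ =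
  -- γ₁'/D.
  have hsplit : split (warp γ₁ γ₂ ψ) ξ (t, u) (inc (ψ u)) =
      ((-(a / D), 0), deriv γ₁ t / D) := by
    rw [← split_frame hbij ((-(a / D), 0), deriv γ₁ t / D), frame_apply, H.fderiv_apply, hξ]
    congr 1
    have q₁ : deriv γ₁ t * -(a / D) + deriv γ₁ t / D * a = 0 := by field_simp; ring
    have q₂ : deriv γ₂ t * -(a / D) + deriv γ₁ t / D * b = 1 := by
      field_simp
      rw [hDdef]; ring
    simp only [map_zero, smul_zero, add_zero, map_smul]
    linear_combination (norm := module) -(q₁ • north) - q₂ • inc (ψ u)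
  have hσ : radial γ₁ γ₂ ψ ξ (t, u) = deriv γ₁ t / D := by rw [radial, hsplit]
  have hM := H.isWarpMetric hbij h₁ h₂
  have hσ0 : radial γ₁ γ₂ ψ ξ (t, u) ≠ 0 := by rw [hσ]; exact div_ne_zero h₁ hD
  refine ⟨⟨hbij, ?_, ?_, ?_⟩, ?_, hM, hσ⟩
  · rintro ⟨s, X⟩ hX
    have e₁ : ((s, X) : ℝ × V) = s • (1, 0) + (0, X) := by simp
    have hs := hX (1, 0)
    rw [e₁, map_add, map_smul, add_apply, smul_apply, hM.tt, hM.vt, add_zero] at hs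
    have hs0 : s = 0 := (smul_eq_zero.1 hs).resolve_right (mul_ne_zero (div_ne_zero hW h₁) hσ0)
    have hX0 : X = 0 := H.blaschke.nondegenerate X fun Y => by
      have := hX (0, Y)
      rw [hs0, hM.vv] at this
      have hε0 : ε ≠ 0 := fun h => by simp [h] at hε
      exact (mul_eq_zero.1 this).resolve_left
        (neg_ne_zero.2 (mul_ne_zero (mul_ne_zero hε0 h₂) hσ0))
    rw [hs0, hX0]
    rfl
  · intro X
    rw [transversalForm, hξ', map_smul, split_fderiv hbij]
    simp
  · let e : Module.Basis (Fin 2) ℝ V := Module.finBasisOfFinrankEq ℝ V hV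
    refine volume_eq_of_basis (warpBasis e) ((H.volume_iff hbij e h₁ h₂).2 ?_)
    rw [hσ, abs_div, div_pow]
    have hD' : 0 < |D| := abs_pos.2 hD
    field_simp
    rw [mul_comm] at hvol
    rw [mul_comm (|D| ^ 5) (γ₂ t ^ 2)] at hvol
    rw [← sq_abs (deriv γ₁ t)] at hvol
    linear_combination hvol
  · intro X
    rw [shape, hξ', map_smul, split_fderiv hbij]
    simp

/-- The metric of a warped surface is a Lorentz metric if the signs are right. -/
theorem IsWarpMetric.exists_isLorentzONB (hV : Module.finrank ℝ V = 2)
    (hM : IsWarpMetric γ₁ γ₂ ψ ε t u ξ) (H : IsWarpDatum γ₁ γ₂ ψ ε t u)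
    (hp : ∀ X, X ≠ 0 → 0 < metric ψ (fun q => -(ε • ψ q)) u X X)
    (h₁ : wronskian γ₁ γ₂ t / deriv γ₁ t * radial γ₁ γ₂ ψ ξ (t, u) < 0)
    (h₂ : ε * γ₂ t * radial γ₁ γ₂ ψ ξ (t, u) < 0) :
    ∃ b : Module.Basis (Fin 3) ℝ (ℝ × V), IsLorentzONB (metric (warp γ₁ γ₂ ψ) ξ (t, u)) b := by
  obtain ⟨e, g00, g11, g01, g10⟩ := exists_orthonormal_basis hV
    (metric ψ (fun q => -(ε • ψ q)) u) (metric_symm H.smooth) hp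
  obtain ⟨b, -, -, hb, -⟩ := AffineGeom.exists_isLorentzONB g00 g11 g01 g10 hM.vv hM.tv hM.vt hM.tt
    h₁ (neg_pos.2 h₂)
  exact ⟨b, hb⟩

end Local

/-! ### From manifolds to charts. -/

section Charts

variable {E : Type*} [NormedAddCommGroup E] [NormedSpace ℝ E] {H : Type*} [TopologicalSpace H]
  {I : ModelWithCorners ℝ E H} [I.Boundaryless]
  {M : Type*} [TopologicalSpace M] [ChartedSpace H M] [IsManifold I ∞ M] {n : ℕ}

theorem contDiffAt_inChart {f : M → Fin (n + 1) → ℝ} {U : Set M} (hU : IsOpen U)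
    (hf : ContMDiffOn I 𝓘(ℝ, Fin (n + 1) → ℝ) ∞ f U) {p : M} {y : E}
    (hy : y ∈ (extChartAt I p).target) (hyU : (extChartAt I p).symm y ∈ U) :
    ContDiffAt ℝ ∞ (inChart I f p) y := by
  have h₁ : ContMDiffAt 𝓘(ℝ, E) I ∞ (extChartAt I p).symm y :=
    (contMDiffOn_extChartAt_symm p).contMDiffAt ((isOpen_extChartAt_target p).mem_nhds hy)
  exact ((hf.contMDiffAt (hU.mem_nhds hyU)).comp y h₁).contDiffAt

omit [IsManifold I ∞ M] in
theorem eventually_mem_chart {U : Set M} (hU : IsOpen U) {p : M} {y : E}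
    (hy : y ∈ (extChartAt I p).target) (hyU : (extChartAt I p).symm y ∈ U) :
    ∀ᶠ z in 𝓝 y, z ∈ (extChartAt I p).target ∧ (extChartAt I p).symm z ∈ U := by
  filter_upwards [(isOpen_extChartAt_target p).mem_nhds hy,
    (continuousAt_extChartAt_symm'' hy).eventually (hU.mem_nhds hyU)] with z h₁ h₂
  exact ⟨h₁, h₂⟩

/-- Codazzi and apolarity differentiate the conditions at a point, so these must hold nearby. They
do, as they are imposed throughout each chart over the open set `U`. -/
theorem IsBlaschkeImmersionOn.isBlaschkeNear {f ξ : M → Fin (n + 1) → ℝ} {U : Set M}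
    (hU : IsOpen U) (h : IsBlaschkeImmersionOn I f ξ U) {p : M} {y : E}
    (hy : y ∈ (extChartAt I p).target) (hyU : (extChartAt I p).symm y ∈ U) :
    IsBlaschkeNear (inChart I f p) (inChart I ξ p) y := by
  filter_upwards [eventually_mem_chart hU hy hyU] with z hz
  exact ⟨contDiffAt_inChart hU h.smooth hz.1 hz.2, contDiffAt_inChart hU h.smooth_normal hz.1 hz.2,
    h.blaschke p z hz.1 hz.2⟩

end Charts

/-! ### Warped surfaces over a manifold. -/

section WarpedProduct

variable {N : Type*} [TopologicalSpace N] [ChartedSpace (EuclideanSpace ℝ (Fin 2)) N]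
  {φ : N → Fin 3 → ℝ} {ε : ℝ} {J : Set ℝ} {γ₁ γ₂ : ℝ → ℝ}

theorem extChartAt_modelProd (p : ℝ × N) :
    extChartAt modelProd p = (PartialEquiv.refl ℝ).prod (extChartAt (𝓡 2) p.2) := by
  rw [extChartAt_prod, extChartAt_model_space_eq_id]

/-- The preferred chart of ℝ × N is the identity times a chart of N, so in coordinates one has a
warped surface again and the local results apply. -/
theorem inChart_warp (γ₁ γ₂ : ℝ → ℝ) (φ : N → Fin 3 → ℝ) (p : ℝ × N) :
    inChart modelProd (warp γ₁ γ₂ φ) p = warp γ₁ γ₂ (inChart (𝓡 2) φ p.2) := by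
  rw [inChart, extChartAt_modelProd]
  rfl

variable [IsManifold (𝓡 2) ∞ N]

theorem isWarpDatum_inChart (hφ : IsDefiniteProperAffineSphere φ ε) (hJ : IsOpen J)
    (hγ₁ : ContDiffOn ℝ ∞ γ₁ J) (hγ₂ : ContDiffOn ℝ ∞ γ₂ J) {t : ℝ} (ht : t ∈ J) (p : N)
    {u : EuclideanSpace ℝ (Fin 2)} (hu : u ∈ (extChartAt (𝓡 2) p).target) :
    IsWarpDatum γ₁ γ₂ (inChart (𝓡 2) φ p) ε t u where
  smooth₁ := hγ₁.contDiffAt (hJ.mem_nhds ht)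
  smooth₂ := hγ₂.contDiffAt (hJ.mem_nhds ht)
  smooth := contDiffAt_inChart isOpen_univ hφ.2.1.smooth hu (Set.mem_univ _)
  sign := hφ.1
  blaschke := hφ.2.1.blaschke p u hu (Set.mem_univ _)

omit [IsManifold (𝓡 2) ∞ N] in
theorem contMDiffOn_warp (hφ : IsDefiniteProperAffineSphere φ ε)
    (hγ₁ : ContDiffOn ℝ ∞ γ₁ J) (hγ₂ : ContDiffOn ℝ ∞ γ₂ J) :
    ContMDiffOn modelProd 𝓘(ℝ, Fin 4 → ℝ) ∞ (warp γ₁ γ₂ φ) (J ×ˢ (Set.univ : Set N)) := by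
  have e : warp γ₁ γ₂ φ = fun x : ℝ × N => γ₁ x.1 • north + γ₂ x.1 • inc (φ x.2) :=
    funext fun x => warp_eq γ₁ γ₂ φ x
  have h₁ : ContMDiffOn modelProd 𝓘(ℝ, ℝ) ∞ (fun x : ℝ × N => γ₁ x.1) (J ×ˢ Set.univ) :=
    hγ₁.contMDiffOn.comp contMDiff_fst.contMDiffOn fun x hx => hx.1
  have h₂ : ContMDiffOn modelProd 𝓘(ℝ, ℝ) ∞ (fun x : ℝ × N => γ₂ x.1) (J ×ˢ Set.univ) :=
    hγ₂.contMDiffOn.comp contMDiff_fst.contMDiffOn fun x hx => hx.1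
  have h₃ : ContMDiffOn modelProd 𝓘(ℝ, Fin 4 → ℝ) ∞ (fun x : ℝ × N => inc (φ x.2))
      (J ×ˢ Set.univ) :=
    inc.contDiff.contMDiff.comp_contMDiffOn
      (hφ.2.1.smooth.comp contMDiff_snd.contMDiffOn fun x hx => Set.mem_univ _)
  rw [e]
  exact (h₁.smul contMDiffOn_const).add (h₂.smul h₃)

/-- The symmetries of a warped indefinite affine hypersphere at a point. -/
theorem symmetries_of_warp (hφ : IsDefiniteProperAffineSphere φ ε) (hJ : IsOpen J)
    (hγ₁ : ContDiffOn ℝ ∞ γ₁ J) (hγ₂ : ContDiffOn ℝ ∞ γ₂ J) {ξ : ℝ × N → Fin 4 → ℝ} {c : ℝ}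
    (h : IsIndefiniteAffineHypersphereOn modelProd (warp γ₁ γ₂ φ) ξ c (J ×ˢ Set.univ))
    {p : ℝ × N} (hp : p ∈ J ×ˢ (Set.univ : Set N)) :
    ∃ b : Module.Basis (Fin 3) ℝ (ℝ × EuclideanSpace ℝ (Fin 2)),
      IsLorentzONB (metricAt modelProd (warp γ₁ γ₂ φ) ξ p) b ∧
      (symmetriesAt modelProd (warp γ₁ γ₂ φ) ξ p b ∩ groupSO2 = groupZ3 ∨
        symmetriesAt modelProd (warp γ₁ γ₂ φ) ξ p b ∩ groupSO2 = groupSO2) ∧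
      (differenceTensorAt modelProd (warp γ₁ γ₂ φ) ξ p (b 0) (b 0) ≠ 0 →
        symmetriesAt modelProd (warp γ₁ γ₂ φ) ξ p b ⊆ groupSO2) := by
  have hU : IsOpen (J ×ˢ (Set.univ : Set N)) := hJ.prod isOpen_univ
  have hy := mem_extChartAt_target (I := modelProd) p
  have hyU : (extChartAt modelProd p).symm (extChartAt modelProd p p) ∈
      J ×ˢ (Set.univ : Set N) := by rwa [extChartAt_to_inv]
  have hB := h.isBlaschkeNear hU hy hyU
  have hyp : extChartAt modelProd p p = (p.1, extChartAt (𝓡 2) p.2 p.2) := by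
    rw [extChartAt_modelProd]; rfl
  have hS : ∀ X, shapeAt modelProd (warp γ₁ γ₂ φ) ξ p X = c • X := h.shape_eq p _ hy hyU
  have hL := h.lorentz p hp
  have hd : ∀ᶠ z in 𝓝 (p.1, extChartAt (𝓡 2) p.2 p.2),
      IsWarpDatum γ₁ γ₂ (inChart (𝓡 2) φ p.2) ε z.1 z.2 := by
    filter_upwards [continuousAt_fst.eventually (hJ.mem_nhds hp.1),
      continuousAt_snd.eventually ((isOpen_extChartAt_target (I := 𝓡 2) p.2).mem_nhds
        (mem_extChartAt_target p.2))] with z h₁ h₂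
    exact isWarpDatum_inChart hφ hJ hγ₁ hγ₂ h₁ p.2 h₂
  have em : metricAt modelProd (warp γ₁ γ₂ φ) ξ p = metric (warp γ₁ γ₂ (inChart (𝓡 2) φ p.2))
      (inChart modelProd ξ p) (p.1, extChartAt (𝓡 2) p.2 p.2) := by
    rw [metricAt, inChart_warp, hyp]
  have ek : ∀ X Y, differenceTensorAt modelProd (warp γ₁ γ₂ φ) ξ p X Y = differenceBilin
      (warp γ₁ γ₂ (inChart (𝓡 2) φ p.2)) (inChart modelProd ξ p)
      (p.1, extChartAt (𝓡 2) p.2 p.2) X Y := fun X Y => by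
    rw [differenceTensorAt, inChart_warp, hyp, differenceBilin_apply]
  rw [inChart_warp, hyp] at hB
  rw [em] at hL ⊢
  obtain ⟨b, l, r, q, hb, hK⟩ := exists_isNormalForm (by simp) hd hB (hφ.2.2 p.2) hL
  refine ⟨b, hb, ?_⟩
  rw [ek]
  refine hK.stabilizer hb hS ?_
  simp only [symmetriesAt, em, ek]

/-- A warped surface is an indefinite affine hypersphere with the affine normal
`ξ = k ∂₀ - c f` if the generating curve satisfies the corresponding differential equation. -/
theorem isIndefiniteAffineHypersphereOn_warp (hφ : IsDefiniteProperAffineSphere φ ε)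
    (hJ : IsOpen J) (hγ₁ : ContDiffOn ℝ ∞ γ₁ J) (hγ₂ : ContDiffOn ℝ ∞ γ₂ J) (k c : ℝ)
    (hode : ∀ t ∈ J, γ₂ t ^ 2 *
      |deriv γ₁ t * (-c * γ₂ t) - deriv γ₂ t * (k - c * γ₁ t)| ^ 5 =
        Real.sign (deriv γ₁ t * γ₂ t * ε) * wronskian γ₁ γ₂ t * deriv γ₁ t ^ 2)
    (hsign : ∀ t ∈ J, (deriv γ₁ t * (-c * γ₂ t) - deriv γ₂ t * (k - c * γ₁ t)) *
      (deriv γ₁ t * γ₂ t * ε) < 0) :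
    IsIndefiniteAffineHypersphereOn modelProd (warp γ₁ γ₂ φ)
      (fun x => k • north - c • warp γ₁ γ₂ φ x) c (J ×ˢ Set.univ) := by
  have hf := contMDiffOn_warp hφ hγ₁ hγ₂
  have hc : ContMDiffOn modelProd 𝓘(ℝ, ℝ) ∞ (fun _ : ℝ × N => c) (J ×ˢ Set.univ) :=
    contMDiffOn_const
  have hcf : ContMDiffOn modelProd 𝓘(ℝ, Fin 4 → ℝ) ∞ (fun x : ℝ × N => c • warp γ₁ γ₂ φ x)
    (J ×ˢ Set.univ) := hc.smul hf
  have key : ∀ p : ℝ × N, ∀ y ∈ (extChartAt modelProd p).target,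
      (extChartAt modelProd p).symm y ∈ J ×ˢ (Set.univ : Set N) →
      IsWarpDatum γ₁ γ₂ (inChart (𝓡 2) φ p.2) ε y.1 y.2 ∧
      IsBlaschkeNormalAt (inChart modelProd (warp γ₁ γ₂ φ) p)
        (inChart modelProd (fun x => k • north - c • warp γ₁ γ₂ φ x) p) y ∧
      (∀ X, shape (inChart modelProd (warp γ₁ γ₂ φ) p)
        (inChart modelProd (fun x => k • north - c • warp γ₁ γ₂ φ x) p) y X = c • X) ∧
      IsWarpMetric γ₁ γ₂ (inChart (𝓡 2) φ p.2) ε y.1 y.2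
        (inChart modelProd (fun x => k • north - c • warp γ₁ γ₂ φ x) p) ∧
      wronskian γ₁ γ₂ y.1 / deriv γ₁ y.1 * radial γ₁ γ₂ (inChart (𝓡 2) φ p.2)
        (inChart modelProd (fun x => k • north - c • warp γ₁ γ₂ φ x) p) y < 0 ∧
      ε * γ₂ y.1 * radial γ₁ γ₂ (inChart (𝓡 2) φ p.2)
        (inChart modelProd (fun x => k • north - c • warp γ₁ γ₂ φ x) p) y < 0 := by
    rintro p ⟨t, u⟩ hy hyU
    rw [extChartAt_modelProd] at hy hyU
    have ht : t ∈ J := hyU.1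
    have hu : u ∈ (extChartAt (𝓡 2) p.2).target := hy.2
    have hd := isWarpDatum_inChart hφ hJ hγ₁ hγ₂ ht p.2 hu
    have e : inChart modelProd (fun x => k • north - c • warp γ₁ γ₂ φ x) p =
        fun z => k • north - c • warp γ₁ γ₂ (inChart (𝓡 2) φ p.2) z := by
      rw [← inChart_warp]; rfl
    rw [e, inChart_warp]
    have ho := hode t ht
    have hs := hsign t ht
    set D := deriv γ₁ t * (-c * γ₂ t) - deriv γ₂ t * (k - c * γ₁ t) with hD
    have hD0 : D ≠ 0 := fun h => by rw [h, zero_mul] at hs; exact lt_irrefl _ hs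
    have hs0 : deriv γ₁ t * γ₂ t * ε ≠ 0 := fun h => by
      rw [h, mul_zero] at hs; exact lt_irrefl _ hs
    have h₁ : deriv γ₁ t ≠ 0 := (mul_ne_zero_iff.1 (mul_ne_zero_iff.1 hs0).1).1
    have h₂ : γ₂ t ≠ 0 := (mul_ne_zero_iff.1 (mul_ne_zero_iff.1 hs0).1).2
    -- The left side of the differential equation is positive, so W has the sign of γ₁'γ₂ε. The
    -- equation thus holds with |W|, which is the volume condition.
    have hpos : 0 < Real.sign (deriv γ₁ t * γ₂ t * ε) * wronskian γ₁ γ₂ t := by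
      have h₃ : 0 < γ₂ t ^ 2 * |D| ^ 5 := by positivity
      rw [ho] at h₃
      exact pos_of_mul_pos_left h₃ (sq_nonneg _)
    have hW : wronskian γ₁ γ₂ t ≠ 0 := (mul_ne_zero_iff.1 hpos.ne').2
    have habs : Real.sign (deriv γ₁ t * γ₂ t * ε) * wronskian γ₁ γ₂ t = |wronskian γ₁ γ₂ t| := by
      rw [← abs_of_pos hpos, abs_mul]
      rcases hs0.lt_or_gt with h | h
      · simp [Real.sign_of_neg h]
      · simp [Real.sign_of_pos h]
    -- Since σ = γ₁'/D, these are h(∂ₜ, ∂ₜ) and minus the factor of the surface metric, so their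
    -- signs make h Lorentzian.
    have hWD : wronskian γ₁ γ₂ t / D < 0 ∧ deriv γ₁ t * γ₂ t * ε / D < 0 := by
      rcases hs0.lt_or_gt with h | h
      · rw [Real.sign_of_neg h] at hpos
        have hDp : 0 < D := by
          by_contra hn
          exact absurd hs (not_lt.2 (mul_nonneg_of_nonpos_of_nonpos (not_lt.1 hn) h.le))
        exact ⟨div_neg_of_neg_of_pos (by linarith) hDp, div_neg_of_neg_of_pos h hDp⟩
      · rw [Real.sign_of_pos h] at hpos
        have hDn : D < 0 := by
          by_contra hn
          exact absurd hs (not_lt.2 (mul_nonneg (not_lt.1 hn) h.le))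
        exact ⟨div_neg_of_pos_of_neg (by linarith) hDn, div_neg_of_pos_of_neg h hDn⟩
    obtain ⟨r₁, r₂, r₃, r₄⟩ := hd.isBlaschkeNormalAt (by simp)
      (ξ := fun z => k • north - c • warp γ₁ γ₂ (inChart (𝓡 2) φ p.2) z)
      (a := k - c * γ₁ t) (b := -c * γ₂ t) (c := c)
      (by simp only [warp_eq]; module)
      (fun X => by
        have h₅ := (contDiffAt_warp hd.smooth₁ hd.smooth₂ hd.smooth).differentiableAt (by simp)
        have h₆ : HasFDerivAt (fun z => k • north - c • warp γ₁ γ₂ (inChart (𝓡 2) φ p.2) z) _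
          (t, u) := (h₅.hasFDerivAt.const_smul c).const_sub (k • north)
        rw [h₆.fderiv]
        simp)
      h₁ h₂ hW hD0 (by rw [← habs]; exact ho)
    refine ⟨hd, r₁, r₂, r₃, ?_, ?_⟩
    · rw [r₄, ← hD]
      have : wronskian γ₁ γ₂ t / deriv γ₁ t * (deriv γ₁ t / D) = wronskian γ₁ γ₂ t / D := by
        field_simp
      simp only [this, hWD.1]
    · rw [r₄, ← hD]
      have : ε * γ₂ t * (deriv γ₁ t / D) = deriv γ₁ t * γ₂ t * ε / D := by ring
      simp only [this, hWD.2]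
  refine
    { smooth := hf
      smooth_normal := contMDiffOn_const.sub hcf
      blaschke := fun p y hy hyU => (key p y hy hyU).2.1
      shape_eq := fun p y hy hyU => (key p y hy hyU).2.2.1
      lorentz := fun p hp => ?_ }
  obtain ⟨hd, -, -, hM, h₁, h₂⟩ := key p _ (mem_extChartAt_target p)
    (by rwa [extChartAt_to_inv])
  have hyp : extChartAt modelProd p p = (p.1, extChartAt (𝓡 2) p.2 p.2) := by
    rw [extChartAt_modelProd]; rfl
  rw [metricAt, inChart_warp]
  rw [hyp] at hd hM h₁ h₂ ⊢
  exact hM.exists_isLorentzONB (by simp) hd (hφ.2.2 p.2) h₁ h₂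

end WarpedProduct

/-! ### The theorem, with the sign choices on the interval. -/

theorem pos_or_neg_of_ne_zero {J : Set ℝ} (hJ : J.OrdConnected) {m : ℝ → ℝ}
    (hm : ContinuousOn m J) (h0 : ∀ t ∈ J, m t ≠ 0) :
    (∀ t ∈ J, 0 < m t) ∨ ∀ t ∈ J, m t < 0 := by
  by_contra! h
  obtain ⟨⟨a, ha, ha'⟩, b, hb, hb'⟩ := h
  obtain ⟨x, hx, hx0⟩ := hJ.isPreconnected.intermediate_value ha hb hm ⟨ha', hb'⟩
  exact h0 x hx hx0

end AffineGeom

theorem mainTheorem6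
    {N : Type*} [TopologicalSpace N] [ChartedSpace (EuclideanSpace ℝ (Fin 2)) N]
    [IsManifold (𝓡 2) ∞ N] (φ : N → Fin 3 → ℝ) (ε : ℝ)
    (hφ : IsDefiniteProperAffineSphere φ ε)
    (J : Set ℝ) (hJ : IsOpen J) (hJ' : J.OrdConnected)
    (γ₁ γ₂ : ℝ → ℝ) (hγ₁ : ContDiffOn ℝ ∞ γ₁ J) (hγ₂ : ContDiffOn ℝ ∞ γ₂ J) :
    (∀ (ξ : ℝ × N → Fin 4 → ℝ) (c : ℝ),
      IsIndefiniteAffineHypersphereOn modelProd (warp γ₁ γ₂ φ) ξ c (J ×ˢ Set.univ) →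
        (AdmitsPointwiseSymmetryOn modelProd (warp γ₁ γ₂ φ) ξ (J ×ˢ Set.univ) groupZ3 ∨
          AdmitsPointwiseSymmetryOn modelProd (warp γ₁ γ₂ φ) ξ (J ×ˢ Set.univ) groupSO2) ∧
        ∀ p ∈ J ×ˢ (Set.univ : Set N),
          ∃ b : Module.Basis (Fin 3) ℝ (ℝ × EuclideanSpace ℝ (Fin 2)),
            IsLorentzONB (metricAt modelProd (warp γ₁ γ₂ φ) ξ p) b ∧
            (symmetriesAt modelProd (warp γ₁ γ₂ φ) ξ p b ∩ groupSO2 = groupZ3 ∨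
              symmetriesAt modelProd (warp γ₁ γ₂ φ) ξ p b ∩ groupSO2 = groupSO2) ∧
            (differenceTensorAt modelProd (warp γ₁ γ₂ φ) ξ p (b 0) (b 0) ≠ 0 →
              symmetriesAt modelProd (warp γ₁ γ₂ φ) ξ p b ⊆ groupSO2)) ∧
    ((∀ t ∈ J,
        γ₂ t ^ 2 * |γ₁ t * deriv γ₂ t - deriv γ₁ t * γ₂ t| ^ 5 =
          Real.sign (deriv γ₁ t * γ₂ t * ε) *
            (deriv γ₁ t * deriv (deriv γ₂) t - deriv (deriv γ₁) t * deriv γ₂ t) *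
            deriv γ₁ t ^ 2 ∧
        γ₂ t ^ 2 * |γ₁ t * deriv γ₂ t - deriv γ₁ t * γ₂ t| ^ 5 ≠ 0) →
      ∃ (ξ : ℝ × N → Fin 4 → ℝ) (c : ℝ), (c = 1 ∨ c = -1) ∧
        IsIndefiniteAffineHypersphereOn modelProd (warp γ₁ γ₂ φ) ξ c (J ×ˢ Set.univ)) ∧
    ((∀ t ∈ J,
        γ₂ t ^ 2 * |deriv γ₂ t| ^ 5 =
          Real.sign (deriv γ₁ t * γ₂ t * ε) *
            (deriv γ₁ t * deriv (deriv γ₂) t - deriv (deriv γ₁) t * deriv γ₂ t) *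
            deriv γ₁ t ^ 2 ∧
        γ₂ t ^ 2 * |deriv γ₂ t| ^ 5 ≠ 0) →
      ∃ ξ : ℝ × N → Fin 4 → ℝ,
        IsIndefiniteAffineHypersphereOn modelProd (warp γ₁ γ₂ φ) ξ 0 (J ×ˢ Set.univ)) := by
  have hd₁ : ContDiffOn ℝ ∞ (deriv γ₁) J := hγ₁.deriv_of_isOpen hJ (by simp)
  have hd₂ : ContDiffOn ℝ ∞ (deriv γ₂) J := hγ₂.deriv_of_isOpen hJ (by simp)
  have hε0 : ε ≠ 0 := by rcases hφ.1 with h | h <;> rw [h] <;> norm_num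
  -- The stabilizer may change type from point to point, but ℤ₃ ⊆ SO(2), so a ℤ₃-symmetry exists
  -- everywhere.
  refine ⟨fun ξ c h => ⟨Or.inl fun p hp => ?_, fun p hp => symmetries_of_warp hφ hJ hγ₁ hγ₂ h hp⟩,
    fun hode => ?_, fun hode => ?_⟩
  · obtain ⟨b, hb, hG, -⟩ := symmetries_of_warp hφ hJ hγ₁ hγ₂ h hp
    refine ⟨b, hb, ?_⟩
    rcases hG with hG | hG
    · exact hG ▸ Set.inter_subset_left
    · exact fun A hA => (Set.inter_eq_right.1 hG) (groupZ3_le_groupSO2 hA)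
  -- Here k = 0 and D = c(γ₁γ₂' - γ₁'γ₂). The constant c must make D · γ₁'γ₂ε negative on the whole
  -- interval, so this function needs a constant sign.
  · have hs := pos_or_neg_of_ne_zero hJ'
      (m := fun t => (γ₁ t * deriv γ₂ t - deriv γ₁ t * γ₂ t) * (deriv γ₁ t * γ₂ t * ε))
      (((hγ₁.continuousOn.mul hd₂.continuousOn).sub (hd₁.continuousOn.mul hγ₂.continuousOn)).mul
        ((hd₁.continuousOn.mul hγ₂.continuousOn).mul continuousOn_const)) fun t ht => by
      obtain ⟨h₁, h₂⟩ := hode t ht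
      have h₃ := h₂
      rw [h₁] at h₃
      simp only [ne_eq, mul_eq_zero, not_or, pow_eq_zero_iff, abs_eq_zero, OfNat.ofNat_ne_zero,
        not_false_eq_true] at h₂ h₃
      exact mul_ne_zero h₂.2 (mul_ne_zero (mul_ne_zero h₃.2 h₂.1) hε0)
    rcases hs with hs | hs
    · refine ⟨_, -1, Or.inr rfl, isIndefiniteAffineHypersphereOn_warp hφ hJ hγ₁ hγ₂ 0 (-1)
        (fun t ht => ?_) fun t ht => ?_⟩
      · rw [wronskian, ← (hode t ht).1, ← abs_neg]
        ring_nf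
      · have := hs t ht
        linarith
    · refine ⟨_, 1, Or.inl rfl, isIndefiniteAffineHypersphereOn_warp hφ hJ hγ₁ hγ₂ 0 1
        (fun t ht => ?_) fun t ht => ?_⟩
      · rw [wronskian, ← (hode t ht).1]
        ring_nf
      · have := hs t ht
        linarith
  -- In the improper case ξ = k∂₀ is constant and D = -kγ₂', so the sign of k plays the role of c.
  · have hs := pos_or_neg_of_ne_zero hJ'
      (m := fun t => deriv γ₂ t * (deriv γ₁ t * γ₂ t * ε))
      (hd₂.continuousOn.mul
        ((hd₁.continuousOn.mul hγ₂.continuousOn).mul continuousOn_const)) fun t ht => by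
      obtain ⟨h₁, h₂⟩ := hode t ht
      have h₃ := h₂
      rw [h₁] at h₃
      simp only [ne_eq, mul_eq_zero, not_or, pow_eq_zero_iff, abs_eq_zero, OfNat.ofNat_ne_zero,
        not_false_eq_true] at h₂ h₃
      exact mul_ne_zero h₂.2 (mul_ne_zero (mul_ne_zero h₃.2 h₂.1) hε0)
    rcases hs with hs | hs
    · refine ⟨_, isIndefiniteAffineHypersphereOn_warp hφ hJ hγ₁ hγ₂ 1 0
        (fun t ht => ?_) fun t ht => ?_⟩
      · rw [wronskian, ← (hode t ht).1, ← abs_neg]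
        ring_nf
      · have := hs t ht
        linarith
    · refine ⟨_, isIndefiniteAffineHypersphereOn_warp hφ hJ hγ₁ hγ₂ (-1) 0
        (fun t ht => ?_) fun t ht => ?_⟩
      · rw [wronskian, ← (hode t ht).1]
        ring_nf
      · have := hs t ht
        linarith
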